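/- Let $(M,g)$ be a smooth 5-dimensional Riemannian manifold with Levi-Civita connection $\nabla^{LC}$. An (irreducible) $SO(3)$ structure on $(M,g)$ is a smooth rank 3 tensor field $\Upsilon$ such that the maps $\Upsilon_v\in\operatorname{End}(TM)$ given by $g(u,\Upsilon_v w)=\Upsilon(u,w,v)$ satisfy: $\Upsilon$ is totally symmetric, $\operatorname{tr}\Upsilon_v=0$, and $\Upsilon_v^2v=g(v,v)\,v$ for all $v$. It is nearly integrable if $(\nabla^{LC}_v\Upsilon)(v,v,v)=0$ for all $v\in TM$. A characteristic connection of $(M,g,\Upsilon)$ is a linear connection $\Gamma$ on $TM$ that preserves $g$ and $\Upsilon$ (an $\mathfrak{so}(3)$ connection) and whose torsion $T(u,v,w)=g(u,\nabla^\Gamma_v w-\nabla^\Gamma_w v-[v,w])$ is totally skew symmetric, so that $T$ is a 3-form. For a linear connection with curvature $R(u,w)=[\nabla_u,\nabla_w]-\nabla_{[u,w]}$ the Ricci tensor is $Ric(v,w)=\operatorname{tr}\big(u\mapsto R(u,w)v\big)$, that is, $Ric_{jl}=\sum_i K_{ijil}$ in an orthonormal frame with curvature forms $K^i{}_j=\tfrac12K^i{}_{jkl}\theta^k\wedge\theta^l$.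 **Proposition.** Let $(M,g,\Upsilon)$ be a nearly integrable $SO(3)$ structure, $\Gamma$ its characteristic connection, and $T$ the torsion 3-form of $\Gamma$. Then, in components with respect to every orthonormal basis of every tangent space, $$Ric^{LC}_{ij}=Ric^{\Gamma}_{ij}+\tfrac14\sum_{k,l}T_{ikl}T_{jkl}+\tfrac12(*\,d*T)_{ij},$$ where $*$ is the Hodge star of $g$ (for either choice of local orientation). **Corollary.** For such $(M,g,\Upsilon)$ the codifferential $d^*T=-*d*T$ of the torsion 3-form vanishes identically on $M$ if and only if $Ric^\Gamma$ is symmetric. -/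

import Mathlib

open Bundle Manifold VectorField
open scoped ContDiff InnerProductSpace Topology

noncomputable section

namespace SO3Geometry

/-- The model space of 5-dimensional manifolds. -/
abbrev E5 : Type := EuclideanSpace ℝ (Fin 5)

/-- The tangent space at `x` of a 5-dimensional manifold `M`. -/
abbrev TS {M : Type*} [TopologicalSpace M] [ChartedSpace E5 M] (x : M) : Type :=
  TangentSpace (𝓡 5) x

/-! ### Hodge star on 3-forms of an oriented 5-dimensional Euclidean space -/

section Hodge

variable {V : Type*} [NormedAddCommGroup V] [InnerProductSpace ℝ V] [FiniteDimensional ℝ V]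
  [Fact (Module.finrank ℝ V = 5)]

/-- The metric volume form, as a continuous alternating map. -/
def volForm (o : Orientation ℝ V (Fin 5)) : V [⋀^Fin 5]→L[ℝ] ℝ :=
  o.volumeForm.mkContinuous 1 fun v => by
    simpa using o.abs_volumeForm_apply_le v

/-- The Hodge star `Λ³ → Λ²` in dimension 5: in an orthonormal basis `e`,
`(*α)(v, w) = (1/3!) ∑ i j k, α(e i, e j, e k) vol(e i, e j, e k, v, w)`. With this normalization
`β ∧ *α = ⟨β, α⟩ vol`. -/
def hodgeStar (o : Orientation ℝ V (Fin 5)) (α : V [⋀^Fin 3]→L[ℝ] ℝ) : V [⋀^Fin 2]→L[ℝ] ℝ :=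
  (1 / 6 : ℝ) • ∑ i, ∑ j, ∑ k,
    α ![stdOrthonormalBasis ℝ V i, stdOrthonormalBasis ℝ V j, stdOrthonormalBasis ℝ V k] •
      (((volForm o).curryLeft (stdOrthonormalBasis ℝ V i)).curryLeft
        (stdOrthonormalBasis ℝ V j)).curryLeft (stdOrthonormalBasis ℝ V k)

end Hodge

section Manifold

variable {M : Type*} [TopologicalSpace M] [ChartedSpace E5 M]

instance (x : M) : FiniteDimensional ℝ (TS x) :=
  inferInstanceAs (FiniteDimensional ℝ E5)

instance (x : M) : Fact (Module.finrank ℝ (TS x) = 5) :=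
  ⟨(finrank_euclideanSpace_fin : Module.finrank ℝ E5 = 5)⟩

/-! ### Exterior derivative -/

/-- The exterior derivative at `x` of a differential form on `M`: read the form in the chart
`φ` at `x` (pull it back by `φ⁻¹`), differentiate there, and pull the result back by `φ`. -/
def extDerivAt [IsManifold (𝓡 5) ∞ M] {n : ℕ} (α : ∀ y : M, TS y [⋀^Fin n]→L[ℝ] ℝ) (x : M) :
    TS x [⋀^Fin (n + 1)]→L[ℝ] ℝ :=
  (extDeriv (𝕜 := ℝ) (E := E5) (F := ℝ)
    (fun u => (α ((extChartAt (𝓡 5) x).symm u)).compContinuousLinearMap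
      (mfderiv 𝓘(ℝ, E5) (𝓡 5) (extChartAt (𝓡 5) x).symm u))
    (extChartAt (𝓡 5) x x)).compContinuousLinearMap
      (mfderiv (𝓡 5) 𝓘(ℝ, E5) (extChartAt (𝓡 5) x) x)

open Classical in
/-- The orientation of the tangent spaces `T_y M` for which the coordinate frame of the chart
at `x` is positive, for `y` in the domain of that chart (and a junk value elsewhere). -/
def chartOrientation [IsManifold (𝓡 5) ∞ M] (x y : M) : Orientation ℝ (TS y) (Fin 5) :=
  if hy : y ∈ (trivializationAt E5 (TangentSpace (𝓡 5)) x).baseSet then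
    ((trivializationAt E5 (TangentSpace (𝓡 5)) x).basisAt
      (EuclideanSpace.basisFun (Fin 5) ℝ).toBasis hy).orientation
  else ((EuclideanSpace.basisFun (Fin 5) ℝ).toBasis : Module.Basis (Fin 5) ℝ E5).orientation

variable [RiemannianBundle (fun x : M => TangentSpace (𝓡 5) x)]

/-- The operator `* d *` on 3-forms. The two Hodge stars are taken for the same orientation near
`x`, that of the chart at `x`; as there are two of them, the result at `x` does not depend on the
choice of the orientation near `x`. -/
def starDStar [IsManifold (𝓡 5) ∞ M] (α : ∀ y : M, TS y [⋀^Fin 3]→L[ℝ] ℝ) (x : M) :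
    TS x [⋀^Fin 2]→L[ℝ] ℝ :=
  hodgeStar (chartOrientation x x)
    (extDerivAt (fun y => hodgeStar (chartOrientation x y) (α y)) x)

/-- The codifferential on 3-forms of a Riemannian 5-manifold, `d^* = - * d *`. -/
def codifferential [IsManifold (𝓡 5) ∞ M] (α : ∀ y : M, TS y [⋀^Fin 3]→L[ℝ] ℝ) (x : M) :
    TS x [⋀^Fin 2]→L[ℝ] ℝ :=
  -starDStar α x

/-! ### Linear connections, curvature, Ricci tensor -/

/-- Linear connections on the tangent bundle of `M`. For a connection `D`, `D Y x v` is
`∇_v Y` at `x`. -/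
abbrev LinearConnection (M : Type*) [TopologicalSpace M] [ChartedSpace E5 M]
    [IsManifold (𝓡 5) ∞ M] : Type _ :=
  CovariantDerivative (𝓡 5) E5 (TangentSpace (𝓡 5) : M → Type _)

/-- `∇_X ∇_Y Z - ∇_Y ∇_X Z - ∇_[X,Y] Z` at `x`. -/
def curvatureField [IsManifold (𝓡 5) ∞ M] (D : LinearConnection M) (X Y Z : ∀ x : M, TS x)
    (x : M) : TS x :=
  D (fun y => D Z y (Y y)) x (X x) - D (fun y => D Z y (X y)) x (Y x)
    - D Z x (mlieBracket (𝓡 5) X Y x)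

/-- The curvature tensor `R(u, v) w` at `x`, computed by extending the three vectors to vector
fields that are smooth near `x`. -/
def curvature [IsManifold (𝓡 5) ∞ M] (D : LinearConnection M) (x : M) (u v w : TS x) : TS x :=
  curvatureField D (FiberBundle.extend E5 u) (FiberBundle.extend E5 v) (FiberBundle.extend E5 w) x

/-- The Ricci tensor `Ric(v, w) = tr (u ↦ R(u, w) v)`. In an orthonormal frame, with curvature
forms `K^i_j = (1/2) K^i_{jkl} θ^k ∧ θ^l`, this is `Ric_{jl} = K_{ijil}`. -/
def ricci [IsManifold (𝓡 5) ∞ M] (D : LinearConnection M) (x : M) (v w : TS x) : ℝ :=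
  ∑ i, ⟪stdOrthonormalBasis ℝ (TS x) i, curvature D x (stdOrthonormalBasis ℝ (TS x) i) w v⟫_ℝ

variable [IsManifold (𝓡 5) ∞ M]
  [IsContMDiffRiemannianBundle (𝓡 5) ∞ E5 (fun x : M => TangentSpace (𝓡 5) x)]

instance : IsContMDiffRiemannianBundle (𝓡 5) 1 E5 (fun x : M => TangentSpace (𝓡 5) x) :=
  IsContMDiffRiemannianBundle.of_le (n := ∞) (by simp)

/-- The Levi-Civita connection: the smooth torsion-free metric connection. -/
structure IsLeviCivita (D : LinearConnection M) : Prop where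
  smooth : CovariantDerivative.ContMDiffCovariantDerivative D ∞
  metric : D.IsMetricCompatible
  torsion_free : D.torsion = 0

/-! ### `SO(3)` structures -/

variable (M) in
/-- An (irreducible) `SO(3)` structure on a Riemannian 5-manifold: a smooth rank 3 tensor field
`Υ`, given as `v ↦ Υ_v ∈ End(TM)`, so that `Υ(u, v, w) = g(u, Υ_v w)`. -/
structure SO3Structure where
  /-- `ups x v w = Υ_v w`. -/
  ups : ∀ x : M, TS x →L[ℝ] TS x →L[ℝ] TS x
  smooth : ContMDiff (𝓡 5) ((𝓡 5).prod 𝓘(ℝ, E5 →L[ℝ] E5 →L[ℝ] E5)) ∞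
    (fun x => TotalSpace.mk' (E5 →L[ℝ] E5 →L[ℝ] E5)
      (E := fun x : M => TangentSpace (𝓡 5) x →L[ℝ] TangentSpace (𝓡 5) x →L[ℝ]
        TangentSpace (𝓡 5) x) x (ups x))
  symm_left : ∀ (x : M) (u v w : TS x), ⟪u, ups x v w⟫_ℝ = ⟪w, ups x v u⟫_ℝ
  symm_right : ∀ (x : M) (u v w : TS x), ⟪u, ups x v w⟫_ℝ = ⟪u, ups x w v⟫_ℝ
  trace_free : ∀ (x : M) (v : TS x), LinearMap.trace ℝ (TS x) (ups x v : TS x →ₗ[ℝ] TS x) = 0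
  sq_apply : ∀ (x : M) (v : TS x), ups x v (ups x v v) = ⟪v, v⟫_ℝ • v

/-- `(∇_z Υ)(U, V, W)` at `x`, for a tangent vector `z` at `x` and vector fields `U, V, W`. -/
def SO3Structure.covDeriv (S : SO3Structure M) (D : LinearConnection M) (x : M) (z : TS x)
    (U V W : ∀ x : M, TS x) : ℝ :=
  mvfderiv (𝓡 5) (fun y : M => ⟪U y, S.ups y (V y) (W y)⟫_ℝ) x z
    - ⟪D U x z, S.ups x (V x) (W x)⟫_ℝ
    - ⟪U x, S.ups x (D V x z) (W x)⟫_ℝ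
    - ⟪U x, S.ups x (V x) (D W x z)⟫_ℝ

/-- Near integrability: `(∇_v Υ)(v, v, v) = 0` for the Levi-Civita connection. -/
def SO3Structure.IsNearlyIntegrable (S : SO3Structure M) : Prop :=
  ∀ D : LinearConnection M, IsLeviCivita D → ∀ (x : M) (V : ∀ x : M, TS x),
    MDifferentiableAt (𝓡 5) (𝓡 5).tangent (fun y => (⟨y, V y⟩ : TangentBundle (𝓡 5) M)) x →
      S.covDeriv D x (V x) V V V = 0

/-- An `so(3)` connection of the `SO(3)` structure: a smooth connection that is compatible with
the structure, i.e. for which `g` and `Υ` are parallel. Equivalently, since `so(3)` is the Lie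
algebra of the stabilizer of `(g, Υ)`, its connection form in adapted frames is
`so(3)`-valued. -/
structure SO3Structure.IsConnection (S : SO3Structure M) (D : LinearConnection M) : Prop where
  smooth : CovariantDerivative.ContMDiffCovariantDerivative D ∞
  metric : D.IsMetricCompatible
  parallel : ∀ (x : M) (z : TS x) (U V W : ∀ x : M, TS x),
    MDifferentiableAt (𝓡 5) (𝓡 5).tangent (fun y => (⟨y, U y⟩ : TangentBundle (𝓡 5) M)) x →
    MDifferentiableAt (𝓡 5) (𝓡 5).tangent (fun y => (⟨y, V y⟩ : TangentBundle (𝓡 5) M)) x →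
    MDifferentiableAt (𝓡 5) (𝓡 5).tangent (fun y => (⟨y, W y⟩ : TangentBundle (𝓡 5) M)) x →
      S.covDeriv D x z U V W = 0

/-- The torsion tensor `T(u, v, w) = g(u, ∇_v w - ∇_w v - [v, w])` is totally skew symmetric.
(Skewness in the last two arguments holds for every connection.) -/
def HasSkewTorsion (D : LinearConnection M) : Prop :=
  ∀ (x : M) (u v w : TS x), ⟪u, D.torsion x v w⟫_ℝ = -⟪v, D.torsion x u w⟫_ℝ

/-- A characteristic connection: an `so(3)` connection with totally skew symmetric torsion. -/
structure SO3Structure.IsCharacteristic (S : SO3Structure M) (D : LinearConnection M) : Prop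
    extends S.IsConnection D where
  skew : HasSkewTorsion D

/-- The torsion 3-form `T(u, v, w) = g(u, T(v, w))` of a connection with totally skew symmetric
torsion. -/
def torsionForm (D : LinearConnection M) (hD : HasSkewTorsion D) (x : M) :
    TS x [⋀^Fin 3]→L[ℝ] ℝ where
  toFun v := ⟪v 0, D.torsion x (v 1) (v 2)⟫_ℝ
  map_update_add' := by
    intro inst v i a b
    obtain rfl : inst = instDecidableEqFin 3 := Subsingleton.elim _ _
    obtain rfl | rfl | rfl : i = 0 ∨ i = 1 ∨ i = 2 := by lia
    all_goals simp [inner_add_left, inner_add_right]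
  map_update_smul' := by
    intro inst v i c a
    obtain rfl : inst = instDecidableEqFin 3 := Subsingleton.elim _ _
    obtain rfl | rfl | rfl : i = 0 ∨ i = 1 ∨ i = 2 := by lia
    all_goals simp [inner_smul_left, inner_smul_right]
  map_eq_zero_of_eq' v i j hv hij := by
    have h01 : ∀ a b : TS x, ⟪a, D.torsion x a b⟫_ℝ = 0 := fun a b => by
      have := hD x a a b; linarith
    have h02 : ∀ a b : TS x, ⟪a, D.torsion x b a⟫_ℝ = 0 := fun a b => by
      rw [D.torsion_antisymm, inner_neg_right, h01, neg_zero]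
    have h12 : ∀ a b : TS x, ⟪a, D.torsion x b b⟫_ℝ = 0 := fun a b => by
      rw [D.torsion_self, inner_zero_right]
    obtain rfl | rfl | rfl : i = 0 ∨ i = 1 ∨ i = 2 := by lia
    all_goals obtain rfl | rfl | rfl : j = 0 ∨ j = 1 ∨ j = 2 := by lia
    all_goals first | exact absurd rfl hij | simp only [hv, h01, h02, h12]
  cont := by fun_prop

end Manifold

end SO3Geometry

end

/-!
Let `T` be the torsion 3-form of a metric connection `Γ` with totally skew symmetric torsion, and
`∇` the Levi-Civita connection.

Since `Γ = ∇ + T / 2` (`apply_eq_leviCivita_add`), the curvatures differ by a derivative of `T` and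
a quadratic term in `T`; in the Ricci contraction, skewness of `T` and of `∇T` leaves
`Ric^Γ(v, w) = Ric^LC(v, w) + (1/2) ∑ i, (∇_{e i} T)(e i, w, v)
  - (1/4) ∑ i, ⟪T(e i, v), T(e i, w)⟫` (`ricci_eq_ricci_leviCivita_add`).
The linear term is the divergence of `T`, so everything reduces to the identity
`(*d*T)(v, w) = ∑ i, (∇_{e i} T)(e i, v, w)` (`starDStar_torsionForm`).

For this identity, the exterior derivative is first computed in coordinate fields of the chart
(`extDerivAt_apply`). The Hodge star is parallel (`hasDirDeriv_star`): this comes from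
differentiating `A ∧ v♭ ∧ w♭ = (*A)(v, w) vol` (`alternatization_mulForm`) in a coordinate frame
that is orthonormal at the point, where the volume is, up to a constant sign, the square root of the
Gram determinant (`frameVolume_eq_sqrt`). As `∇` is torsion free, the terms with derivatives
of the coordinate fields cancel, and `d*T` is the cyclic sum of `*(∇_u T)(v, w)`. What
is left is the linear algebra of `*(u♭ ∧ *A) = ι_u A` (`sum_star3_mul_volumeForm`).

Finally `Ric^LC` is symmetric (`ricci_leviCivita_symm`) and so is the quadratic term. Hence the skew
part of `Ric^Γ` is `-(1/2) *d*T` (`ricci_sub_ricci_swap`), and one vanishes exactly when the other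
does.
-/

noncomputable section

namespace SO3Geometry

/-! ### Coordinate fields and curvature -/

section LocalFields

variable {M : Type*} [TopologicalSpace M] [ChartedSpace E5 M]

/-- Differentiability of a vector field at a point. -/
abbrev DiffAt (σ : ∀ y : M, TangentSpace (𝓡 5) y) (x : M) [IsManifold (𝓡 5) ∞ M] : Prop :=
  MDifferentiableAt (𝓡 5) (𝓡 5).tangent (fun y => (⟨y, σ y⟩ : TangentBundle (𝓡 5) M)) x

/-- Smoothness of a vector field at a point. -/
abbrev SmoothAt (σ : ∀ y : M, TangentSpace (𝓡 5) y) (x : M) [IsManifold (𝓡 5) ∞ M] : Prop :=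
  ContMDiffAt (𝓡 5) (𝓡 5).tangent ∞ (fun y => (⟨y, σ y⟩ : TangentBundle (𝓡 5) M)) x

/-- Smoothness of a vector field on a neighbourhood of a point. -/
def SmoothNear (σ : ∀ y : M, TangentSpace (𝓡 5) y) (x : M) [IsManifold (𝓡 5) ∞ M] : Prop :=
  ∀ᶠ y in 𝓝 x, SmoothAt σ y

variable [IsManifold (𝓡 5) ∞ M]

theorem SmoothAt.diffAt {σ : ∀ y : M, TangentSpace (𝓡 5) y} {x : M} (h : SmoothAt σ x) :
    DiffAt σ x := h.mdifferentiableAt (by simp)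

theorem SmoothNear.diffAt {σ : ∀ y : M, TangentSpace (𝓡 5) y} {x : M} (h : SmoothNear σ x) :
    DiffAt σ x := h.self_of_nhds.diffAt

theorem SmoothNear.eventually_diffAt {σ : ∀ y : M, TangentSpace (𝓡 5) y} {x : M}
    (h : SmoothNear σ x) : ∀ᶠ y in 𝓝 x, DiffAt σ y := by
  filter_upwards [h] with y hy using hy.diffAt

/-- The map from the tangent space at `x` to the one at `y` that preserves components in the chart
at `x` (for `y` outside the domain of that chart it is a junk value). -/
def extendL (x y : M) : TangentSpace (𝓡 5) x →L[ℝ] TangentSpace (𝓡 5) y :=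
  ((trivializationAt E5 (TangentSpace (𝓡 5)) x).symmL ℝ y).comp
      ((trivializationAt E5 (TangentSpace (𝓡 5)) x).continuousLinearMapAt ℝ x)

theorem extend_eq_extendL {x y : M} (v : TangentSpace (𝓡 5) x) (hy : y ∈ (chartAt E5 x).source) :
    FiberBundle.extend E5 v y = extendL x y v := by
  unfold extendL FiberBundle.extend
  rw [ContinuousLinearMap.comp_apply, Trivialization.continuousLinearMapAt_apply,
    Trivialization.coe_linearMapAt_of_mem _ (FiberBundle.mem_baseSet_trivializationAt E5 _ x)]
  exact (Trivialization.symmL_apply _ (by simpa using hy) _).symm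

theorem smoothAt_extend {x y : M} (v : TangentSpace (𝓡 5) x) (hy : y ∈ (chartAt E5 x).source) :
    SmoothAt (FiberBundle.extend E5 v) y := by
  have hs : y ∈ (trivializationAt E5 (TangentSpace (𝓡 5)) x).baseSet := by simpa using hy
  refine ((trivializationAt E5 (TangentSpace (𝓡 5)) x).contMDiffAt_section_iff hs).2 ?_
  refine (contMDiffAt_const (c := (trivializationAt E5 (TangentSpace (𝓡 5)) x ⟨x, v⟩).2))
    |>.congr_of_eventuallyEq ?_
  filter_upwards [(trivializationAt E5 (TangentSpace (𝓡 5)) x).open_baseSet.mem_nhds hs] with z hz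
  simp only [FiberBundle.extend]
  rw [Trivialization.apply_mk_symm _ hz]

theorem smoothNear_extend {x : M} (v : TangentSpace (𝓡 5) x) :
    SmoothNear (FiberBundle.extend E5 v) x := by
  filter_upwards [(chartAt E5 x).open_source.mem_nhds (mem_chart_source E5 x)] with y hy
    using smoothAt_extend v hy

/-- Near `x`, the fields `FiberBundle.extend E5 v` are pullbacks of constant fields under the chart
at `x`, so they commute. -/
theorem mlieBracket_extend {x y : M} (u v : TangentSpace (𝓡 5) x)
    (hy : y ∈ (chartAt E5 x).source) :
    mlieBracket (𝓡 5) (FiberBundle.extend E5 u) (FiberBundle.extend E5 v) y = 0 := by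
  let C : TangentSpace (𝓡 5) x → ∀ z : E5, TangentSpace 𝓘(ℝ, E5) z := fun v _ =>
    (trivializationAt E5 (TangentSpace (𝓡 5)) x).continuousLinearMapAt ℝ x v
  have h : ∀ v : TangentSpace (𝓡 5) x, (FiberBundle.extend E5 v : ∀ y : M, TangentSpace (𝓡 5) y)
      =ᶠ[𝓝 y] mpullback (𝓡 5) 𝓘(ℝ, E5) (extChartAt (𝓡 5) x) (C v) := by
    intro v
    filter_upwards [(chartAt E5 x).open_source.mem_nhds hy] with z hz
    have hz' : z ∈ (trivializationAt E5 (TangentSpace (𝓡 5)) x).baseSet := by simpa using hz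
    have h1 := (Trivialization.coe_continuousLinearEquivAt_eq' (R := ℝ) _ hz').trans
      (TangentBundle.continuousLinearMapAt_trivializationAt hz)
    have h2 := ContinuousLinearMap.inverse_equiv
      ((trivializationAt E5 (TangentSpace (𝓡 5)) x).continuousLinearEquivAt ℝ z hz')
    rw [h1] at h2
    refine (extend_eq_extendL v hz).trans
      (Eq.trans ?_ (DFunLike.congr_fun h2 (C v (extChartAt (𝓡 5) x z))).symm)
    exact (congrFun (Trivialization.symm_continuousLinearEquivAt_eq (R := ℝ) _ hz') _).symm
  have hC : ∀ v, MDifferentiableAt 𝓘(ℝ, E5) 𝓘(ℝ, E5).tangent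
      (fun z => (⟨z, C v z⟩ : TangentBundle 𝓘(ℝ, E5) E5)) (extChartAt (𝓡 5) x y) := by
    intro v
    have := contMDiffAt_vectorSpace_iff_contDiffAt (n := 1) (V := C v) (x := extChartAt (𝓡 5) x y)
    exact (this.2 contDiffAt_const).mdifferentiableAt (by simp)
  have : IsManifold (𝓡 5) (minSmoothness ℝ 2) M := by
    simpa using IsManifold.of_le (n := ∞) (m := 2) ENat.LEInfty.out
  rw [(h u).mlieBracket_vectorField_eq (h v), ← mpullback_mlieBracket (n := ∞) (hC u) (hC v)
    (contMDiffAt_extChartAt' hy) (by simpa using ENat.LEInfty.out (m := 2))]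
  rw [mpullback_apply]
  rw [← mlieBracketWithin_univ, mlieBracketWithin_eq_lieBracketWithin]
  have hc : ∀ c d z : E5, lieBracketWithin ℝ (fun _ : E5 => c) (fun _ => d) Set.univ z = 0 := by
    intro c d z
    simp [lieBracketWithin]
  exact (congrArg _ (hc _ _ _)).trans (map_zero _)

/-- The vector field near `x` with value `v` at `x` that has constant components in the chart
at `x`. -/
def constField (x : M) (v : TangentSpace (𝓡 5) x) (y : M) : TangentSpace (𝓡 5) y :=
  extendL x y v

theorem extend_eventuallyEq {x : M} (v : TangentSpace (𝓡 5) x) :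
    ∀ᶠ y in 𝓝 x, (FiberBundle.extend E5 v : ∀ y : M, TangentSpace (𝓡 5) y) y
      = constField x v y := by
  filter_upwards [(chartAt E5 x).open_source.mem_nhds (mem_chart_source E5 x)] with y hy
    using extend_eq_extendL v hy

@[simp]
theorem constField_self (x : M) (v : TangentSpace (𝓡 5) x) : constField x v x = v := by
  rw [← (extend_eventuallyEq v).self_of_nhds]
  exact FiberBundle.extend_apply_self E5 v

theorem smoothNear_congr {x : M} {σ τ : ∀ y : M, TangentSpace (𝓡 5) y} (hσ : SmoothNear σ x)
    (h : ∀ᶠ y in 𝓝 x, σ y = τ y) : SmoothNear τ x := by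
  filter_upwards [hσ, h.eventually_nhds] with y hy h'
  exact hy.congr_of_eventuallyEq (h'.mono fun z hz => by simp [hz])

theorem smoothNear_constField {x : M} (v : TangentSpace (𝓡 5) x) :
    SmoothNear (constField x v) x :=
  smoothNear_congr (smoothNear_extend v) (extend_eventuallyEq v)

theorem diffAt_constField {x : M} (v : TangentSpace (𝓡 5) x) : DiffAt (constField x v) x :=
  (smoothNear_constField v).diffAt

theorem mlieBracket_constField {x : M} (u v : TangentSpace (𝓡 5) x) :
    ∀ᶠ y in 𝓝 x, mlieBracket (𝓡 5) (constField x u) (constField x v) y = 0 := by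
  filter_upwards [(chartAt E5 x).open_source.mem_nhds (mem_chart_source E5 x),
    (extend_eventuallyEq u).eventually_nhds, (extend_eventuallyEq v).eventually_nhds]
    with y hy hu hv
  rw [← mlieBracket_extend u v hy]
  exact (Filter.EventuallyEq.mlieBracket_vectorField_eq hu hv).symm

theorem constField_add (x : M) (u v : TangentSpace (𝓡 5) x) :
    constField x (u + v) = constField x u + constField x v := by
  ext1 y; exact map_add _ _ _

theorem constField_smul (x : M) (c : ℝ) (v : TangentSpace (𝓡 5) x) :
    constField x (c • v) = c • constField x v := by
  ext1 y; exact map_smul (extendL x y) _ _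

/-- A field that is smooth near `x` agrees near `x` with a globally smooth one. -/
theorem exists_smooth_eq [T2Space M] {x : M} (σ : ∀ y : M, TangentSpace (𝓡 5) y)
    (hσ : SmoothNear σ x) :
    ∃ τ : ∀ y : M, TangentSpace (𝓡 5) y, (∀ y, SmoothAt τ y) ∧ ∀ᶠ y in 𝓝 x, σ y = τ y := by
  obtain ⟨U, hU, hUo, hxU⟩ := eventually_nhds_iff.1 hσ
  obtain ⟨f, hf, hfU⟩ := ((SmoothBumpFunction.nhds_basis_tsupport (I := 𝓡 5) (c := x)).mem_iff).1
    (hUo.mem_nhds hxU)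
  refine ⟨(f : M → ℝ) • σ, ?_, ?_⟩
  · exact ContMDiffOn.smul_section_of_tsupport f.contMDiff.contMDiffOn hUo hfU
      fun y hy => (hU y hy).contMDiffWithinAt
  · filter_upwards [f.eventuallyEq_one] with y hy
    simp [hy]

theorem covariantDerivative_congr (D : LinearConnection M) {x : M}
    {σ τ : ∀ y : M, TangentSpace (𝓡 5) y} (hσ : DiffAt σ x)
    (h : ∀ᶠ y in 𝓝 x, σ y = τ y) : D σ x = D τ x :=
  D.isCovariantDerivativeOnUniv.congr_of_eventuallyEq hσ
    (hσ.congr_of_eventuallyEq (h.mono fun y hy => by simp [hy])) Filter.univ_mem h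

theorem SmoothNear.covariantDerivative [T2Space M] (D : LinearConnection M)
    (hD : CovariantDerivative.ContMDiffCovariantDerivative D ∞) {x : M}
    {σ τ : ∀ y : M, TangentSpace (𝓡 5) y}
    (hσ : SmoothNear σ x) (hτ : SmoothNear τ x) :
    SmoothNear (fun y => D σ y (τ y)) x := by
  -- Smoothness of `D` is a statement about globally smooth fields, whence the extension `ρ`.
  obtain ⟨ρ, hρ, he⟩ := exists_smooth_eq σ hσ
  have h1 := hD.contMDiff.contMDiff (σ := ρ) fun y _ => (hρ y).contMDiffWithinAt
  filter_upwards [he.eventually_nhds, hσ.eventually_nhds, hτ] with y hy hs ht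
  have h3 : SmoothAt (fun y => D ρ y (τ y)) y :=
    ContMDiffAt.clm_bundle_apply (h1.contMDiffAt Filter.univ_mem) ht
  refine h3.congr_of_eventuallyEq ?_
  filter_upwards [hy.eventually_nhds, hs] with z hz hs'
  rw [covariantDerivative_congr D hs'.diffAt hz]

/-- The curvature may be computed with the constant fields of the chart, whose brackets vanish. -/
theorem curvature_eq [T2Space M] [RiemannianBundle (fun x : M => TangentSpace (𝓡 5) x)]
    (D : LinearConnection M)
    (hD : CovariantDerivative.ContMDiffCovariantDerivative D ∞) (x : M)
    (u v w : TangentSpace (𝓡 5) x) :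
    curvature D x u v w =
      D (fun y => D (constField x w) y (constField x v y)) x u
        - D (fun y => D (constField x w) y (constField x u y)) x v := by
  have h : ∀ v : TangentSpace (𝓡 5) x,
      D (fun y => D (FiberBundle.extend E5 w) y (FiberBundle.extend E5 v y)) x =
      D (fun y => D (constField x w) y (constField x v y)) x := by
    intro v
    refine covariantDerivative_congr D
      ((smoothNear_extend w).covariantDerivative D hD (smoothNear_extend v)).diffAt ?_
    filter_upwards [(smoothNear_extend w).eventually_diffAt, extend_eventuallyEq v,
      (extend_eventuallyEq w).eventually_nhds] with y hw' hv hw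
    rw [hv, covariantDerivative_congr D hw' hw]
  unfold curvature curvatureField
  rw [h, h, mlieBracket_extend u v (mem_chart_source E5 x)]
  simp

end LocalFields

/-! ### The Levi-Civita derivative of the torsion, and the Ricci tensors -/

section Connections

variable {M : Type*} [TopologicalSpace M] [ChartedSpace E5 M] [IsManifold (𝓡 5) ∞ M]
  [RiemannianBundle (fun x : M => TangentSpace (𝓡 5) x)]

theorem inner_torsion_swap (Γ : LinearConnection M) {x : M} (u v w : TangentSpace (𝓡 5) x) :
    ⟪u, Γ.torsion x v w⟫_ℝ = -⟪u, Γ.torsion x w v⟫_ℝ := by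
  rw [Γ.torsion_antisymm, inner_neg_right]

/-- The Levi-Civita covariant derivative `(∇_u T)(a, b, c)` of the torsion form
`T(a, b, c) = ⟪a, T(b, c)⟫` of `Γ`, with `a, b, c` extended to coordinate fields. -/
def nablaT (LC Γ : LinearConnection M) (x : M) (u a b c : TangentSpace (𝓡 5) x) : ℝ :=
  mvfderiv (𝓡 5)
      (fun y => ⟪constField x a y, Γ.torsion y (constField x b y) (constField x c y)⟫_ℝ) x u
    - ⟪LC (constField x a) x u, Γ.torsion x b c⟫_ℝ
    - ⟪a, Γ.torsion x (LC (constField x b) x u) c⟫_ℝ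
    - ⟪a, Γ.torsion x b (LC (constField x c) x u)⟫_ℝ

theorem nablaT_swap_left {LC Γ : LinearConnection M} (hs : HasSkewTorsion Γ) (x : M)
    (u a b c : TangentSpace (𝓡 5) x) : nablaT LC Γ x u a b c = -nablaT LC Γ x u b a c := by
  have h : (fun y => ⟪constField x a y, Γ.torsion y (constField x b y) (constField x c y)⟫_ℝ)
      = -(fun y => ⟪constField x b y, Γ.torsion y (constField x a y) (constField x c y)⟫_ℝ) := by
    ext y; exact hs _ _ _ _
  unfold nablaT
  rw [h, mvfderiv_neg, hs x a b, hs x a, hs x (LC _ x u)]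
  simp only [neg_apply]
  ring

theorem nablaT_swap_right {LC Γ : LinearConnection M} (x : M)
    (u a b c : TangentSpace (𝓡 5) x) : nablaT LC Γ x u a b c = -nablaT LC Γ x u a c b := by
  have h : (fun y => ⟪constField x a y, Γ.torsion y (constField x b y) (constField x c y)⟫_ℝ)
      = -(fun y => ⟪constField x a y, Γ.torsion y (constField x c y) (constField x b y)⟫_ℝ) := by
    ext y; exact inner_torsion_swap _ _ _ _
  unfold nablaT
  rw [h, mvfderiv_neg, inner_torsion_swap Γ _ b c, inner_torsion_swap Γ a b,
    inner_torsion_swap Γ a _ c]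
  simp only [neg_apply]
  ring

variable [IsContMDiffRiemannianBundle (𝓡 5) ∞ E5 (fun x : M => TangentSpace (𝓡 5) x)]

theorem mdifferentiableAt_inner {x : M} {σ τ : ∀ y : M, TangentSpace (𝓡 5) y}
    (hσ : DiffAt σ x) (hτ : DiffAt τ x) :
    MDifferentiableAt (𝓡 5) 𝓘(ℝ, ℝ) (fun y => ⟪σ y, τ y⟫_ℝ) x :=
  hσ.inner_bundle hτ

theorem mvfderiv_inner {D : LinearConnection M} (hD : D.IsMetricCompatible) {x : M}
    {σ τ : ∀ y : M, TangentSpace (𝓡 5) y} (hσ : DiffAt σ x) (hτ : DiffAt τ x)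
    (u : TangentSpace (𝓡 5) x) :
    mvfderiv (𝓡 5) (fun y => ⟪σ y, τ y⟫_ℝ) x u = ⟪D σ x u, τ x⟫_ℝ + ⟪σ x, D τ x u⟫_ℝ := by
  simpa using hD.mvfderiv_inner_eq (constField x u) hσ hτ

/-- `∇_V W = ∇_W V` for coordinate fields. -/
theorem IsLeviCivita.symm {LC : LinearConnection M} (hLC : IsLeviCivita LC) {x : M}
    (v w : TangentSpace (𝓡 5) x) :
    ∀ᶠ y in 𝓝 x, LC (constField x w) y (constField x v y)
      = LC (constField x v) y (constField x w y) := by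
  filter_upwards [mlieBracket_constField v w, (smoothNear_constField v).eventually_diffAt,
    (smoothNear_constField w).eventually_diffAt] with y h hv hw
  have := LC.torsion_eq_zero_iff.1 hLC.torsion_free hv hw
  rw [h] at this
  exact sub_eq_zero.1 this

theorem IsLeviCivita.symm_self {LC : LinearConnection M} (hLC : IsLeviCivita LC) {x : M}
    (v w : TangentSpace (𝓡 5) x) :
    LC (constField x w) x v = LC (constField x v) x w := by
  simpa using (hLC.symm v w).self_of_nhds

/-- A metric connection with totally skew symmetric torsion `T` is `∇^{LC} + T / 2`. -/
theorem apply_eq_leviCivita_add {LC Γ : LinearConnection M} (hLC : IsLeviCivita LC)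
    (hΓ : Γ.IsMetricCompatible) (hs : HasSkewTorsion Γ) {x : M}
    {σ : ∀ y : M, TangentSpace (𝓡 5) y} (hσ : DiffAt σ x) (u : TangentSpace (𝓡 5) x) :
    Γ σ x u = LC σ x u + (1 / 2 : ℝ) • Γ.torsion x u (σ x) := by
  obtain ⟨A, hA⟩ : ∃ A : TangentSpace (𝓡 5) x →L[ℝ] TangentSpace (𝓡 5) x →L[ℝ]
      TangentSpace (𝓡 5) x, ∀ σ : ∀ y : M, TangentSpace (𝓡 5) y, DiffAt σ x →
        A (σ x) = Γ σ x - LC σ x :=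
    ⟨Γ.isCovariantDerivativeOnUniv.difference LC.isCovariantDerivativeOnUniv x, fun σ hσ =>
      IsCovariantDerivativeOn.difference_apply _ _ (Set.mem_univ x) hσ⟩
  have hA' : ∀ v, A v = Γ (constField x v) x - LC (constField x v) x := fun v => by
    simpa using hA _ (diffAt_constField v)
  -- `A v u = Γ_u v - ∇_u v` is skew in `v` and the value, because both connections are metric.
  have skew : ∀ u v w, ⟪A v u, w⟫_ℝ = -⟪A w u, v⟫_ℝ := by
    intro u v w
    have h1 := mvfderiv_inner hΓ (diffAt_constField v) (diffAt_constField w) u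
    have h2 := mvfderiv_inner hLC.metric (diffAt_constField v) (diffAt_constField w) u
    simp only [constField_self] at h1 h2
    rw [hA', hA', sub_apply, sub_apply, inner_sub_left,
      inner_sub_left, real_inner_comm v, real_inner_comm v]
    linarith
  -- As `∇` is torsion free, the skew part of `A` is the torsion of `Γ`.
  have tors : ∀ u v w, ⟪A v u, w⟫_ℝ - ⟪A u v, w⟫_ℝ = ⟪w, Γ.torsion x u v⟫_ℝ := by
    intro u v w
    have h1 := Γ.torsion_apply (diffAt_constField u) (diffAt_constField v)
    simp only [constField_self] at h1
    rw [(mlieBracket_constField u v).self_of_nhds] at h1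
    rw [h1, hA', hA', sub_apply, sub_apply,
      hLC.symm_self, real_inner_comm, real_inner_comm w, ← inner_sub_right]
    congr 1
    module
  have hhalf : ∀ w, ⟪w, A (σ x) u⟫_ℝ = ⟪w, (1 / 2 : ℝ) • Γ.torsion x u (σ x)⟫_ℝ := by
    intro w
    rw [inner_smul_right, real_inner_comm]
    have t1 := hs x u (σ x) w
    have t2 := hs x w u (σ x)
    have t3 := inner_torsion_swap Γ (σ x) u w
    have s1 := skew u (σ x) w
    have s2 := skew (σ x) u w
    have s3 := skew w u (σ x)
    have r1 := tors u (σ x) w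
    have r2 := tors (σ x) w u
    have r3 := tors w u (σ x)
    linarith
  have h := ext_inner_left ℝ hhalf
  rw [hA σ hσ] at h
  rw [← h]
  simp

variable [T2Space M]

/-- The torsion is smooth because it is twice the difference of two smooth connections. -/
theorem smoothNear_torsion {LC Γ : LinearConnection M} (hLC : IsLeviCivita LC)
    (hm : Γ.IsMetricCompatible) (hs : HasSkewTorsion Γ)
    (hΓ : CovariantDerivative.ContMDiffCovariantDerivative Γ ∞) {x : M}
    {σ τ : ∀ y : M, TangentSpace (𝓡 5) y} (hσ : SmoothNear σ x) (hτ : SmoothNear τ x) :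
    SmoothNear (fun y => Γ.torsion y (σ y) (τ y)) x := by
  have h : SmoothNear (fun y => (2 : ℝ) • (Γ τ y (σ y) - LC τ y (σ y))) x := by
    filter_upwards [hτ.covariantDerivative Γ hΓ hσ, hτ.covariantDerivative LC hLC.smooth hσ]
      with y h1 h2
    exact (h1.sub_section h2).const_smul_section
  refine smoothNear_congr h ?_
  filter_upwards [hτ.eventually_diffAt] with y hy
  rw [apply_eq_leviCivita_add hLC hm hs hy]
  module

theorem mdifferentiableAt_inner_torsion {LC Γ : LinearConnection M} (hLC : IsLeviCivita LC)
    (hm : Γ.IsMetricCompatible) (hs : HasSkewTorsion Γ)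
    (hΓ : CovariantDerivative.ContMDiffCovariantDerivative Γ ∞) {x : M}
    (a b c : TangentSpace (𝓡 5) x) :
    MDifferentiableAt (𝓡 5) 𝓘(ℝ, ℝ)
      (fun y => ⟪constField x a y, Γ.torsion y (constField x b y) (constField x c y)⟫_ℝ) x :=
  mdifferentiableAt_inner (diffAt_constField a)
    (smoothNear_torsion hLC hm hs hΓ (smoothNear_constField b) (smoothNear_constField c)).diffAt

theorem nablaT_add {LC Γ : LinearConnection M} (hLC : IsLeviCivita LC)
    (hm : Γ.IsMetricCompatible) (hs : HasSkewTorsion Γ)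
    (hΓ : CovariantDerivative.ContMDiffCovariantDerivative Γ ∞) {x : M}
    (u a a' b c : TangentSpace (𝓡 5) x) :
    nablaT LC Γ x u (a + a') b c = nablaT LC Γ x u a b c + nablaT LC Γ x u a' b c := by
  have h : (fun y => ⟪constField x (a + a') y,
      Γ.torsion y (constField x b y) (constField x c y)⟫_ℝ)
      = (fun y => ⟪constField x a y, Γ.torsion y (constField x b y) (constField x c y)⟫_ℝ)
      + (fun y => ⟪constField x a' y, Γ.torsion y (constField x b y) (constField x c y)⟫_ℝ) := by
    ext y; simp [constField_add, inner_add_left]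
  unfold nablaT
  rw [h, mvfderiv_add (mdifferentiableAt_inner_torsion hLC hm hs hΓ _ _ _)
    (mdifferentiableAt_inner_torsion hLC hm hs hΓ _ _ _), constField_add,
    LC.isCovariantDerivativeOnUniv.add (diffAt_constField a) (diffAt_constField a')]
  simp only [add_apply, inner_add_left]
  ring

theorem nablaT_smul {LC Γ : LinearConnection M} (hLC : IsLeviCivita LC)
    (hm : Γ.IsMetricCompatible) (hs : HasSkewTorsion Γ)
    (hΓ : CovariantDerivative.ContMDiffCovariantDerivative Γ ∞) {x : M} (r : ℝ)
    (u a b c : TangentSpace (𝓡 5) x) :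
    nablaT LC Γ x u (r • a) b c = r * nablaT LC Γ x u a b c := by
  have h : (fun y => ⟪constField x (r • a) y,
      Γ.torsion y (constField x b y) (constField x c y)⟫_ℝ)
      = (fun _ : M => r) •
        (fun y => ⟪constField x a y, Γ.torsion y (constField x b y) (constField x c y)⟫_ℝ) := by
    ext y; simp [constField_smul, inner_smul_left]
  unfold nablaT
  rw [h, mvfderiv_smul mdifferentiableAt_const
    (mdifferentiableAt_inner_torsion hLC hm hs hΓ _ _ _), constField_smul,
    LC.isCovariantDerivativeOnUniv.smul_const r (diffAt_constField a)]
  simp only [mvfderiv_const]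
  simp [inner_smul_left]
  ring

/-- The covariant derivative of `y ↦ T(B, C)` in terms of `∇T`. -/
theorem inner_leviCivita_torsion {LC Γ : LinearConnection M} (hLC : IsLeviCivita LC)
    (hm : Γ.IsMetricCompatible) (hs : HasSkewTorsion Γ)
    (hΓ : CovariantDerivative.ContMDiffCovariantDerivative Γ ∞) {x : M}
    (u a b c : TangentSpace (𝓡 5) x) :
    ⟪a, LC (fun y => Γ.torsion y (constField x b y) (constField x c y)) x u⟫_ℝ
      = nablaT LC Γ x u a b c + ⟪a, Γ.torsion x (LC (constField x b) x u) c⟫_ℝ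
        + ⟪a, Γ.torsion x b (LC (constField x c) x u)⟫_ℝ := by
  have h := mvfderiv_inner hLC.metric (diffAt_constField a) (smoothNear_torsion hLC hm hs hΓ
    (smoothNear_constField b) (smoothNear_constField c)).diffAt u
  simp only [constField_self] at h
  unfold nablaT
  rw [h]
  ring

theorem curvature_eq_curvature_leviCivita_add {LC Γ : LinearConnection M} (hLC : IsLeviCivita LC)
    (hm : Γ.IsMetricCompatible) (hs : HasSkewTorsion Γ)
    (hΓ : CovariantDerivative.ContMDiffCovariantDerivative Γ ∞) {x : M}
    (u v w : TangentSpace (𝓡 5) x) :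
    curvature Γ x u v w = curvature LC x u v w
      + (1 / 2 : ℝ) • (LC (fun y => Γ.torsion y (constField x v y) (constField x w y)) x u
        - LC (fun y => Γ.torsion y (constField x u y) (constField x w y)) x v
        + Γ.torsion x u (LC (constField x w) x v) - Γ.torsion x v (LC (constField x w) x u))
      + (1 / 4 : ℝ) • (Γ.torsion x u (Γ.torsion x v w) - Γ.torsion x v (Γ.torsion x u w)) := by
  have key : ∀ u v : TangentSpace (𝓡 5) x,
      Γ (fun y => Γ (constField x w) y (constField x v y)) x u =
        LC (fun y => LC (constField x w) y (constField x v y)) x u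
        + (1 / 2 : ℝ) • LC (fun y => Γ.torsion y (constField x v y) (constField x w y)) x u
        + (1 / 2 : ℝ) • Γ.torsion x u (LC (constField x w) x v)
        + (1 / 4 : ℝ) • Γ.torsion x u (Γ.torsion x v w) := by
    intro u v
    have sΓ := (smoothNear_constField w).covariantDerivative Γ hΓ (smoothNear_constField v)
    have sL := (smoothNear_constField w).covariantDerivative LC hLC.smooth
      (smoothNear_constField v)
    have sT := smoothNear_torsion hLC hm hs hΓ (smoothNear_constField v) (smoothNear_constField w)
    have h1 := covariantDerivative_congr LC
      (τ := (fun y => LC (constField x w) y (constField x v y))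
      + (1 / 2 : ℝ) • (fun y => Γ.torsion y (constField x v y) (constField x w y))) sΓ.diffAt (by
        filter_upwards [(smoothNear_constField w).eventually_diffAt] with y hy
        exact apply_eq_leviCivita_add hLC hm hs hy _)
    have hT' : DiffAt ((1 / 2 : ℝ) •
        (fun y => Γ.torsion y (constField x v y) (constField x w y))) x :=
      sT.diffAt.smul_const_section
    rw [apply_eq_leviCivita_add hLC hm hs sΓ.diffAt, h1,
      LC.isCovariantDerivativeOnUniv.add sL.diffAt hT',
      LC.isCovariantDerivativeOnUniv.smul_const _ sT.diffAt]
    rw [apply_eq_leviCivita_add hLC hm hs (diffAt_constField w)]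
    simp only [constField_self, map_add, map_smul, add_apply,
      smul_apply]
    module
  rw [curvature_eq Γ hΓ, curvature_eq LC hLC.smooth, key, key]
  module

/-- The summands of the Ricci tensors. The terms of the curvature in which `T` meets a derivative of
a coordinate field cancel by skewness of `T` and torsion freeness of `∇`. -/
theorem inner_curvature_self {LC Γ : LinearConnection M} (hLC : IsLeviCivita LC)
    (hm : Γ.IsMetricCompatible) (hs : HasSkewTorsion Γ)
    (hΓ : CovariantDerivative.ContMDiffCovariantDerivative Γ ∞) {x : M}
    (u v w : TangentSpace (𝓡 5) x) :
    ⟪u, curvature Γ x u w v⟫_ℝ = ⟪u, curvature LC x u w v⟫_ℝ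
      + 1 / 2 * nablaT LC Γ x u u w v - 1 / 4 * ⟪Γ.torsion x u v, Γ.torsion x u w⟫_ℝ := by
  have h0 : ∀ a b : TangentSpace (𝓡 5) x, ⟪a, Γ.torsion x a b⟫_ℝ = 0 := fun a b => by
    have := hs x a a b; linarith
  have h1 : nablaT LC Γ x w u u v = 0 := by
    have := nablaT_swap_left (LC := LC) hs x w u u v; linarith
  have h2 : ⟪u, Γ.torsion x w (Γ.torsion x u v)⟫_ℝ = ⟪Γ.torsion x u v, Γ.torsion x u w⟫_ℝ := by
    rw [inner_torsion_swap, hs x u, neg_neg]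
  have h3 := hs x u w (LC (constField x v) x u)
  rw [curvature_eq_curvature_leviCivita_add hLC hm hs hΓ]
  simp only [inner_add_right, inner_sub_right, inner_smul_right, h0, h2,
    inner_leviCivita_torsion hLC hm hs hΓ, h1]
  rw [hLC.symm_self w u]
  ring

theorem ricci_eq_ricci_leviCivita_add {LC Γ : LinearConnection M} (hLC : IsLeviCivita LC)
    (hm : Γ.IsMetricCompatible) (hs : HasSkewTorsion Γ)
    (hΓ : CovariantDerivative.ContMDiffCovariantDerivative Γ ∞) {x : M}
    (v w : TangentSpace (𝓡 5) x) :
    ricci Γ x v w = ricci LC x v w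
      + 1 / 2 * ∑ i, nablaT LC Γ x (stdOrthonormalBasis ℝ (TS x) i)
          (stdOrthonormalBasis ℝ (TS x) i) w v
      - 1 / 4 * ∑ i, ⟪Γ.torsion x (stdOrthonormalBasis ℝ (TS x) i) v,
          Γ.torsion x (stdOrthonormalBasis ℝ (TS x) i) w⟫_ℝ := by
  unfold ricci
  rw [Finset.mul_sum, Finset.mul_sum, ← Finset.sum_add_distrib, ← Finset.sum_sub_distrib]
  exact Finset.sum_congr rfl fun i _ => inner_curvature_self hLC hm hs hΓ _ _ _

/-- The first Bianchi identity. -/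
theorem curvature_bianchi {LC : LinearConnection M} (hLC : IsLeviCivita LC) {x : M}
    (u v w : TangentSpace (𝓡 5) x) :
    curvature LC x u v w + curvature LC x v w u + curvature LC x w u v = 0 := by
  have key : ∀ v w : TangentSpace (𝓡 5) x,
      LC (fun y => LC (constField x w) y (constField x v y)) x
      = LC (fun y => LC (constField x v) y (constField x w y)) x := fun v w =>
    covariantDerivative_congr LC ((smoothNear_constField w).covariantDerivative LC hLC.smooth
      (smoothNear_constField v)).diffAt (hLC.symm v w)
  rw [curvature_eq LC hLC.smooth, curvature_eq LC hLC.smooth, curvature_eq LC hLC.smooth,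
    key u v, key v w, key w u]
  abel

end Connections

/-! ### Functions and differential forms in a chart -/

section Charts

variable {M : Type*} [TopologicalSpace M] [ChartedSpace E5 M]

theorem eventually_extChartAt_symm {x : M} {p : M → Prop} (h : ∀ᶠ y in 𝓝 x, p y) :
    ∀ᶠ z in 𝓝 (extChartAt (𝓡 5) x x), p ((extChartAt (𝓡 5) x).symm z) :=
  (continuousAt_extChartAt_symm (I := 𝓡 5) x).eventually
    (by rwa [extChartAt_to_inv (I := 𝓡 5) x])

variable [IsManifold (𝓡 5) ∞ M]

/-- The isomorphism of the tangent space at `x` with the model space given by the chart at `x`. -/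
def chartL (x : M) : TangentSpace (𝓡 5) x →L[ℝ] E5 :=
  (trivializationAt E5 (TangentSpace (𝓡 5)) x).continuousLinearMapAt ℝ x

theorem chartL_eq_mfderiv (x : M) :
    chartL x = mfderiv (𝓡 5) 𝓘(ℝ, E5) (extChartAt (𝓡 5) x) x :=
  TangentBundle.continuousLinearMapAt_trivializationAt (mem_chart_source E5 x)

theorem chartL_surjective (x : M) : Function.Surjective (chartL x) := fun a =>
  ⟨(trivializationAt E5 (TangentSpace (𝓡 5)) x).symmL ℝ x a,
    Trivialization.continuousLinearMapAt_symmL _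
      (FiberBundle.mem_baseSet_trivializationAt E5 _ x) a⟩

/-- The inverse chart maps constant fields of the model space to coordinate fields. -/
theorem mfderiv_extChartAt_symm_chartL {x : M} {z : E5} (hz : z ∈ (extChartAt (𝓡 5) x).target)
    (v : TangentSpace (𝓡 5) x) :
    mfderiv 𝓘(ℝ, E5) (𝓡 5) (extChartAt (𝓡 5) x).symm z (chartL x v)
      = constField x v ((extChartAt (𝓡 5) x).symm z) := by
  have hy : (extChartAt (𝓡 5) x).symm z ∈ (chartAt E5 x).source := by
    simpa using (extChartAt (𝓡 5) x).map_target hz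
  have h := TangentBundle.symmL_trivializationAt (I := 𝓡 5) hy
  simp only [ModelWithCorners.range_eq_univ, mfderivWithin_univ] at h
  have hcongr : ∀ z' : E5, z' = z →
      (mfderiv 𝓘(ℝ, E5) (𝓡 5) (extChartAt (𝓡 5) x).symm z' : E5 →L[ℝ] E5)
        = mfderiv 𝓘(ℝ, E5) (𝓡 5) (extChartAt (𝓡 5) x).symm z := by
    rintro _ rfl; rfl
  exact (DFunLike.congr_fun (h.trans (hcongr _ ((extChartAt (𝓡 5) x).right_inv hz)))
    (chartL x v)).symm

theorem mdifferentiableAt_extChartAt_symm {x : M} {z : E5}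
    (hz : z ∈ (extChartAt (𝓡 5) x).target) :
    MDifferentiableAt 𝓘(ℝ, E5) (𝓡 5) (extChartAt (𝓡 5) x).symm z := by
  have := mdifferentiableWithinAt_extChartAt_symm (I := 𝓡 5) hz
  rwa [ModelWithCorners.range_eq_univ, mdifferentiableWithinAt_univ] at this

/-- The derivative of a function read in the chart at `x`, in a coordinate direction. -/
theorem hasFDerivAt_comp_extChartAt_symm {x : M} {z : E5}
    (hz : z ∈ (extChartAt (𝓡 5) x).target) {f : M → ℝ}
    (hf : MDifferentiableAt (𝓡 5) 𝓘(ℝ, ℝ) f ((extChartAt (𝓡 5) x).symm z)) :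
    ∃ F : E5 →L[ℝ] ℝ, HasFDerivAt (f ∘ (extChartAt (𝓡 5) x).symm) F z ∧
      ∀ v : TangentSpace (𝓡 5) x, F (chartL x v) =
        mvfderiv (𝓡 5) f ((extChartAt (𝓡 5) x).symm z)
          (constField x v ((extChartAt (𝓡 5) x).symm z)) := by
  have h := hf.hasMFDerivAt.comp z (mdifferentiableAt_extChartAt_symm hz).hasMFDerivAt
  refine ⟨_, h.hasFDerivAt, fun v => ?_⟩
  rw [← mfderiv_extChartAt_symm_chartL hz]
  rfl

theorem fderiv_comp_extChartAt_symm {x : M} {z : E5}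
    (hz : z ∈ (extChartAt (𝓡 5) x).target) {f : M → ℝ}
    (hf : MDifferentiableAt (𝓡 5) 𝓘(ℝ, ℝ) f ((extChartAt (𝓡 5) x).symm z))
    (v : TangentSpace (𝓡 5) x) :
    fderiv ℝ (f ∘ (extChartAt (𝓡 5) x).symm) z (chartL x v) =
        mvfderiv (𝓡 5) f ((extChartAt (𝓡 5) x).symm z)
          (constField x v ((extChartAt (𝓡 5) x).symm z)) := by
  obtain ⟨F, hF, h⟩ := hasFDerivAt_comp_extChartAt_symm hz hf
  rw [hF.fderiv, h]

theorem fderiv_comp_extChartAt_symm_self {x : M} {f : M → ℝ}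
    (hf : MDifferentiableAt (𝓡 5) 𝓘(ℝ, ℝ) f x) (v : TangentSpace (𝓡 5) x) :
    fderiv ℝ (f ∘ (extChartAt (𝓡 5) x).symm) (extChartAt (𝓡 5) x x) (chartL x v) =
        mvfderiv (𝓡 5) f x v := by
  have hx := extChartAt_to_inv (I := 𝓡 5) x
  have h := fderiv_comp_extChartAt_symm (mem_extChartAt_target (I := 𝓡 5) x) (f := f)
    (by rwa [hx]) v
  rw [h, hx, constField_self]

theorem differentiableAt_comp_extChartAt_symm {x : M} {f : M → ℝ}
    (hf : MDifferentiableAt (𝓡 5) 𝓘(ℝ, ℝ) f x) :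
    DifferentiableAt ℝ (f ∘ (extChartAt (𝓡 5) x).symm) (extChartAt (𝓡 5) x x) := by
  obtain ⟨F, hF, -⟩ := hasFDerivAt_comp_extChartAt_symm (mem_extChartAt_target (I := 𝓡 5) x)
    (f := f) (by rwa [extChartAt_to_inv (I := 𝓡 5) x])
  exact hF.differentiableAt

/-- Second derivatives along coordinate fields commute. -/
theorem mvfderiv_mvfderiv_comm {x : M} {f : M → ℝ}
    (hf : ∀ᶠ y in 𝓝 x, ContMDiffAt (𝓡 5) 𝓘(ℝ, ℝ) ∞ f y) (u v : TangentSpace (𝓡 5) x)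
    (hu : MDifferentiableAt (𝓡 5) 𝓘(ℝ, ℝ) (fun y => mvfderiv (𝓡 5) f y (constField x u y)) x)
    (hv : MDifferentiableAt (𝓡 5) 𝓘(ℝ, ℝ) (fun y => mvfderiv (𝓡 5) f y (constField x v y)) x) :
    mvfderiv (𝓡 5) (fun y => mvfderiv (𝓡 5) f y (constField x v y)) x u =
      mvfderiv (𝓡 5) (fun y => mvfderiv (𝓡 5) f y (constField x u y)) x v := by
  set F := f ∘ (extChartAt (𝓡 5) x).symm
  have hF : ContDiffAt ℝ ∞ F (extChartAt (𝓡 5) x x) := by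
    have h0 := hf.self_of_nhds
    have := (contMDiffAt_iff_source (x := x) (I := 𝓡 5)).1 h0
    rwa [ModelWithCorners.range_eq_univ, contMDiffWithinAt_univ, contMDiffAt_iff_contDiffAt]
      at this
  have key : ∀ u v : TangentSpace (𝓡 5) x,
      MDifferentiableAt (𝓡 5) 𝓘(ℝ, ℝ) (fun y => mvfderiv (𝓡 5) f y (constField x v y)) x →
      mvfderiv (𝓡 5) (fun y => mvfderiv (𝓡 5) f y (constField x v y)) x u =
      fderiv ℝ (fderiv ℝ F) (extChartAt (𝓡 5) x x) (chartL x u) (chartL x v) := by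
    intro u v hv
    rw [← fderiv_comp_extChartAt_symm_self hv]
    have he : (fun y => mvfderiv (𝓡 5) f y (constField x v y)) ∘ (extChartAt (𝓡 5) x).symm
        =ᶠ[𝓝 (extChartAt (𝓡 5) x x)] fun z => fderiv ℝ F z (chartL x v) := by
      filter_upwards [(isOpen_extChartAt_target (I := 𝓡 5) x).mem_nhds (mem_extChartAt_target x),
        eventually_extChartAt_symm hf] with z hz hfz
      exact (fderiv_comp_extChartAt_symm hz (hfz.mdifferentiableAt (by simp)) v).symm
    have hd : DifferentiableAt ℝ (fderiv ℝ F) (extChartAt (𝓡 5) x x) :=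
      (hF.fderiv_right (m := 1) (by exact ENat.LEInfty.out (m := 2))).differentiableAt (by simp)
    rw [he.fderiv_eq, fderiv_clm_apply hd (differentiableAt_const _)]
    simp
  rw [key u v hv, key v u hu]
  exact (hF.isSymmSndFDerivAt (by simpa using ENat.LEInfty.out (m := 2))) _ _

/-- A family of alternating forms on `E5` is differentiable if all its evaluations are. -/
theorem differentiableAt_alternating {n : ℕ} {F : E5 → E5 [⋀^Fin n]→L[ℝ] ℝ} {z : E5}
    (h : ∀ v : Fin n → E5, DifferentiableAt ℝ (fun y => F y v) z) : DifferentiableAt ℝ F z := by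
  let b := (EuclideanSpace.basisFun (Fin 5) ℝ).toBasis
  -- Evaluation on basis vectors embeds the alternating forms into a power of `ℝ`.
  let ev : E5 [⋀^Fin n]→L[ℝ] ℝ →ₗ[ℝ] ((Fin n → Fin 5) → ℝ) :=
    { toFun := fun α i => α fun k => b (i k)
      map_add' := fun _ _ => rfl
      map_smul' := fun _ _ => rfl }
  have hinj : LinearMap.ker ev = ⊥ := by
    rw [LinearMap.ker_eq_bot]
    intro α β hαβ
    apply ContinuousAlternatingMap.toAlternatingMap_injective
    refine b.ext_alternating fun i _ => congrFun hαβ i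
  obtain ⟨g, hg⟩ := ev.exists_leftInverse_of_injective hinj
  have hF : F = fun y => (LinearMap.toContinuousLinearMap g) (fun i => F y fun k => b (i k)) := by
    ext1 y
    exact (LinearMap.congr_fun hg (F y)).symm
  rw [hF]
  exact (ContinuousLinearMap.differentiableAt _).comp z (differentiableAt_pi.2 fun i => h _)

/-- The exterior derivative of a 2-form in terms of coordinate fields. The form need not be given as
a differentiable section: differentiability of its components is enough. -/
theorem extDerivAt_apply (β : ∀ y : M, TS y [⋀^Fin 2]→L[ℝ] ℝ) {x : M}
    (hβ : ∀ v w : TangentSpace (𝓡 5) x, MDifferentiableAt (𝓡 5) 𝓘(ℝ, ℝ)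
      (fun y => β y ![constField x v y, constField x w y]) x) (u v w : TangentSpace (𝓡 5) x) :
    extDerivAt β x ![u, v, w] =
      mvfderiv (𝓡 5) (fun y => β y ![constField x v y, constField x w y]) x u
      - mvfderiv (𝓡 5) (fun y => β y ![constField x u y, constField x w y]) x v
      + mvfderiv (𝓡 5) (fun y => β y ![constField x u y, constField x v y]) x w := by
  unfold extDerivAt
  set F : E5 → E5 [⋀^Fin 2]→L[ℝ] ℝ := fun z =>
    (β ((extChartAt (𝓡 5) x).symm z)).compContinuousLinearMap
      (mfderiv 𝓘(ℝ, E5) (𝓡 5) (extChartAt (𝓡 5) x).symm z)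
  have he : ∀ v w : TangentSpace (𝓡 5) x, (fun z => F z ![chartL x v, chartL x w])
      =ᶠ[𝓝 (extChartAt (𝓡 5) x x)]
      (fun y => β y ![constField x v y, constField x w y]) ∘ (extChartAt (𝓡 5) x).symm := by
    intro v w
    filter_upwards [(isOpen_extChartAt_target (I := 𝓡 5) x).mem_nhds (mem_extChartAt_target x)]
      with z hz
    simp only [F, Function.comp]
    rw [← mfderiv_extChartAt_symm_chartL hz, ← mfderiv_extChartAt_symm_chartL hz]
    refine congrArg (β ((extChartAt (𝓡 5) x).symm z)) ?_
    ext1 i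
    fin_cases i <;> rfl
  have hF : DifferentiableAt ℝ F (extChartAt (𝓡 5) x x) := by
    refine differentiableAt_alternating fun a => ?_
    obtain ⟨v, hv⟩ := chartL_surjective x (a 0)
    obtain ⟨w, hw⟩ := chartL_surjective x (a 1)
    have ha : a = ![chartL x v, chartL x w] := by
      rw [hv, hw]; ext i : 1; fin_cases i <;> rfl
    rw [ha]
    exact (differentiableAt_comp_extChartAt_symm (hβ v w)).congr_of_eventuallyEq (he v w)
  have hd : ∀ u v w : TangentSpace (𝓡 5) x,
      fderiv ℝ (fun z => F z ![chartL x v, chartL x w]) (extChartAt (𝓡 5) x x) (chartL x u) =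
      mvfderiv (𝓡 5) (fun y => β y ![constField x v y, constField x w y]) x u := by
    intro u v w
    rw [(he v w).fderiv_eq, fderiv_comp_extChartAt_symm_self (hβ v w)]
  rw [← hd, ← hd, ← hd]
  have hv : (mfderiv (𝓡 5) 𝓘(ℝ, E5) (extChartAt (𝓡 5) x) x) ∘ ![u, v, w] =
      ![chartL x u, chartL x v, chartL x w] := by
    rw [chartL_eq_mfderiv]
    ext i : 1; fin_cases i <;> rfl
  refine (congrArg (extDeriv F (extChartAt (𝓡 5) x x)) hv).trans ?_
  have h0 : (0 : Fin 3).removeNth ![chartL x u, chartL x v, chartL x w] =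
    ![chartL x v, chartL x w] := by ext i : 1; fin_cases i <;> rfl
  have h1 : (1 : Fin 3).removeNth ![chartL x u, chartL x v, chartL x w] =
    ![chartL x u, chartL x w] := by ext i : 1; fin_cases i <;> rfl
  have h2 : (2 : Fin 3).removeNth ![chartL x u, chartL x v, chartL x w] =
    ![chartL x u, chartL x v] := by ext i : 1; fin_cases i <;> rfl
  rw [extDeriv_apply hF, Fin.sum_univ_three, h0, h1, h2]
  simp
  ring

end Charts

/-! ### Symmetry of the Levi-Civita Ricci tensor -/

section RicciSymmetry

theorem mvfderiv_congr {M : Type*} [TopologicalSpace M] [ChartedSpace E5 M] {x : M} {f g : M → ℝ}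
    (h : f =ᶠ[𝓝 x] g) :
    mvfderiv (𝓡 5) f x = mvfderiv (𝓡 5) g x := by
  ext u
  exact DFunLike.congr_fun (h.mfderiv_eq (I := 𝓡 5) (I' := 𝓘(ℝ, ℝ))) u

variable {M : Type*} [TopologicalSpace M] [ChartedSpace E5 M] [IsManifold (𝓡 5) ∞ M]
  [RiemannianBundle (fun x : M => TangentSpace (𝓡 5) x)]
  [IsContMDiffRiemannianBundle (𝓡 5) ∞ E5 (fun x : M => TangentSpace (𝓡 5) x)] [T2Space M]

/-- The curvature of a metric connection takes values in skew endomorphisms: differentiate `⟪W, W⟫`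
twice along coordinate fields and use that the two derivatives commute. -/
theorem inner_curvature_eq_zero {D : LinearConnection M} (hm : D.IsMetricCompatible)
    (hD : CovariantDerivative.ContMDiffCovariantDerivative D ∞) {x : M}
    (u v w : TangentSpace (𝓡 5) x) : ⟪w, curvature D x u v w⟫_ℝ = 0 := by
  set W := constField x w with hW
  have hf : ∀ᶠ y in 𝓝 x, ContMDiffAt (𝓡 5) 𝓘(ℝ, ℝ) ∞ (fun y => ⟪W y, W y⟫_ℝ) y := by
    filter_upwards [smoothNear_constField w] with y hy using hy.inner_bundle hy
  have h1 : ∀ v : TangentSpace (𝓡 5) x,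
      (fun y => mvfderiv (𝓡 5) (fun y => ⟪W y, W y⟫_ℝ) y (constField x v y)) =ᶠ[𝓝 x]
        fun y => ⟪(2 : ℝ) • W y, D W y (constField x v y)⟫_ℝ := by
    intro v
    filter_upwards [(smoothNear_constField w).eventually_diffAt] with y hy
    rw [mvfderiv_inner hm hy hy, real_inner_comm, inner_smul_left]
    simp
    ring
  have s1 : DiffAt ((2 : ℝ) • W) x := (diffAt_constField w).smul_const_section
  have s2 : ∀ v : TangentSpace (𝓡 5) x, DiffAt (fun y => D W y (constField x v y)) x := fun v =>
    ((smoothNear_constField w).covariantDerivative D hD (smoothNear_constField v)).diffAt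
  have h2 : ∀ v : TangentSpace (𝓡 5) x, MDifferentiableAt (𝓡 5) 𝓘(ℝ, ℝ)
      (fun y => mvfderiv (𝓡 5) (fun y => ⟪W y, W y⟫_ℝ) y (constField x v y)) x := fun v =>
    (mdifferentiableAt_inner s1 (s2 v)).congr_of_eventuallyEq (h1 v)
  have h3 := mvfderiv_mvfderiv_comm hf u v (h2 u) (h2 v)
  have h4 : ∀ u v : TangentSpace (𝓡 5) x,
      mvfderiv (𝓡 5) (fun y => ⟪(2 : ℝ) • W y, D W y (constField x v y)⟫_ℝ) x u =
      2 * ⟪D W x u, D W x v⟫_ℝ + 2 * ⟪w, D (fun y => D W y (constField x v y)) x u⟫_ℝ := by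
    intro u v
    have := mvfderiv_inner hm s1 (s2 v) u
    rw [D.isCovariantDerivativeOnUniv.smul_const _ (diffAt_constField w)] at this
    refine this.trans ?_
    simp [inner_smul_left, hW]
  rw [mvfderiv_congr (h1 v), mvfderiv_congr (h1 u), h4, h4] at h3
  rw [curvature_eq D hD, inner_sub_right]
  rw [real_inner_comm] at h3
  linarith

/-- By the first Bianchi identity, the skew part of the Ricci tensor is the trace of a curvature
endomorphism, and that is skew. -/
theorem ricci_leviCivita_symm {LC : LinearConnection M} (hLC : IsLeviCivita LC) {x : M}
    (v w : TangentSpace (𝓡 5) x) : ricci LC x v w = ricci LC x w v := by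
  unfold ricci
  rw [← sub_eq_zero, ← Finset.sum_sub_distrib]
  refine Finset.sum_eq_zero fun i _ => ?_
  set e := stdOrthonormalBasis ℝ (TS x) i
  have h1 := congrArg (fun z => ⟪e, z⟫_ℝ) (curvature_bianchi hLC e w v)
  have h2 := inner_curvature_eq_zero hLC.metric hLC.smooth w v e
  have h3 : curvature LC x v e w = -curvature LC x e v w := by
    rw [curvature_eq LC hLC.smooth, curvature_eq LC hLC.smooth]
    abel
  simp only [inner_add_right, inner_zero_right, h3, inner_neg_right, h2] at h1
  linarith

end RicciSymmetry

/-! ### The Hodge star of a 3-form in dimension 5 -/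

section HodgeAlgebra

theorem sum_eq_of_univ_eq {a b c d e : Fin 5}
    (huniv : (Finset.univ : Finset (Fin 5)) = {a, b, c, d, e})
    (hinj : [a, b, c, d, e].Nodup) (f : Fin 5 → ℝ) :
    ∑ i, f i = f a + f b + f c + f d + f e := by
  rw [huniv]
  simp only [List.nodup_cons, List.mem_cons, not_or, List.not_mem_nil] at hinj
  obtain ⟨⟨h1, h2, h3, h4, -⟩, ⟨h5, h6, h7, -⟩, ⟨h8, h9, -⟩, ⟨h10, -⟩, -⟩ := hinj
  rw [Finset.sum_insert (by simp [*]), Finset.sum_insert (by simp [*]),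
    Finset.sum_insert (by simp [*]), Finset.sum_insert (by simp [*]), Finset.sum_singleton]
  ring

/-- The sum of a symmetric function that vanishes on the diagonal and off `{d, e}`. -/
theorem sum_sum_eq_two_mul {a b c d e : Fin 5}
    (huniv : (Finset.univ : Finset (Fin 5)) = {a, b, c, d, e})
    (hinj : [a, b, c, d, e].Nodup) (g : Fin 5 → Fin 5 → ℝ) (hs : ∀ i j, g i j = g j i)
    (hd : ∀ i, g i i = 0) (ha : ∀ j, g a j = 0) (hb : ∀ j, g b j = 0) (hc : ∀ j, g c j = 0) :
    ∑ i, ∑ j, g i j = 2 * g d e := by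
  have hsum := sum_eq_of_univ_eq huniv hinj
  simp only [hsum, ha, hb, hc, hd, hs _ a, hs _ b, hs _ c]
  rw [hs e d]
  ring

/-- The sum of a symmetric function that vanishes on repeated arguments and off `{a, b, c}`. -/
theorem sum_sum_sum_eq_six_mul {a b c d e : Fin 5}
    (huniv : (Finset.univ : Finset (Fin 5)) = {a, b, c, d, e})
    (hinj : [a, b, c, d, e].Nodup) (f : Fin 5 → Fin 5 → Fin 5 → ℝ)
    (h12 : ∀ i j k, f i j k = f j i k) (h23 : ∀ i j k, f i j k = f i k j)
    (h0 : ∀ i j, f i i j = 0) (hd : ∀ i j, f d i j = 0) (he : ∀ i j, f e i j = 0) :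
    ∑ i, ∑ j, ∑ k, f i j k = 6 * f a b c := by
  have hsum := sum_eq_of_univ_eq huniv hinj
  have h0' : ∀ i j, f i j j = 0 := fun i j => by rw [h12, h23, h0]
  have h0'' : ∀ i j, f i j i = 0 := fun i j => by rw [h23, h0]
  simp only [hsum, h0, h0', h0'', hd, he, h12 _ d, h12 _ e, h23 _ _ d, h23 _ _ e]
  rw [h23 a c b, h12 b a c, h23 b c a, h12 b a c, h12 c a b, h23 a c b, h12 c b a, h23 b c a,
    h12 b a c]
  ring

variable {V : Type*} [NormedAddCommGroup V] [InnerProductSpace ℝ V]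

theorem map_add_vec3 (A : V [⋀^Fin 3]→ₗ[ℝ] ℝ) (a b c d : V) :
    A ![a + b, c, d] = A ![a, c, d] + A ![b, c, d] ∧
    A ![c, a + b, d] = A ![c, a, d] + A ![c, b, d] ∧
    A ![c, d, a + b] = A ![c, d, a] + A ![c, d, b] := by
  have h0 := A.map_update_add ![a, c, d] 0 a b
  have h1 := A.map_update_add ![c, a, d] 1 a b
  have h2 := A.map_update_add ![c, d, a] 2 a b
  have u0 : ∀ q, Function.update ![a, c, d] 0 q = ![q, c, d] := fun q => by
    ext i : 1; fin_cases i <;> rfl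
  have u1 : ∀ q, Function.update ![c, a, d] 1 q = ![c, q, d] := fun q => by
    ext i : 1; fin_cases i <;> rfl
  have u2 : ∀ q, Function.update ![c, d, a] 2 q = ![c, d, q] := fun q => by
    ext i : 1; fin_cases i <;> rfl
  simp only [u0] at h0
  simp only [u1] at h1
  simp only [u2] at h2
  exact ⟨h0, h1, h2⟩

theorem map_smul_vec3 (A : V [⋀^Fin 3]→ₗ[ℝ] ℝ) (r : ℝ) (a c d : V) :
    A ![r • a, c, d] = r * A ![a, c, d] ∧ A ![c, r • a, d] = r * A ![c, a, d] ∧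
    A ![c, d, r • a] = r * A ![c, d, a] := by
  have h0 := A.map_update_smul ![a, c, d] 0 r a
  have h1 := A.map_update_smul ![c, a, d] 1 r a
  have h2 := A.map_update_smul ![c, d, a] 2 r a
  have u0 : ∀ q, Function.update ![a, c, d] 0 q = ![q, c, d] := fun q => by
    ext i : 1; fin_cases i <;> rfl
  have u1 : ∀ q, Function.update ![c, a, d] 1 q = ![c, q, d] := fun q => by
    ext i : 1; fin_cases i <;> rfl
  have u2 : ∀ q, Function.update ![c, d, a] 2 q = ![c, d, q] := fun q => by
    ext i : 1; fin_cases i <;> rfl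
  simp only [u0] at h0
  simp only [u1] at h1
  simp only [u2] at h2
  exact ⟨h0, h1, h2⟩

theorem vec5_swap (f : V [⋀^Fin 5]→ₗ[ℝ] ℝ) (a b c d e : V) :
    f ![b, a, c, d, e] = -f ![a, b, c, d, e] ∧ f ![a, c, b, d, e] = -f ![a, b, c, d, e] ∧
    f ![a, b, d, c, e] = -f ![a, b, c, d, e] ∧ f ![a, b, c, e, d] = -f ![a, b, c, d, e] := by
  have h0 := f.map_swap ![a, b, c, d, e] (i := 0) (j := 1) (by decide)
  have h1 := f.map_swap ![a, b, c, d, e] (i := 1) (j := 2) (by decide)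
  have h2 := f.map_swap ![a, b, c, d, e] (i := 2) (j := 3) (by decide)
  have h3 := f.map_swap ![a, b, c, d, e] (i := 3) (j := 4) (by decide)
  refine ⟨Eq.trans ?_ h0, Eq.trans ?_ h1, Eq.trans ?_ h2, Eq.trans ?_ h3⟩ <;>
    refine congrArg f ?_ <;> ext i : 1 <;> fin_cases i <;> rfl

theorem vec5_cycle (f : V [⋀^Fin 5]→ₗ[ℝ] ℝ) (u a b v w : V) :
    f ![u, a, b, v, w] = f ![a, b, u, v, w] := by
  have h1 := (vec5_swap f u a b v w).1
  have h2 := (vec5_swap f a u b v w).2.1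
  linarith

theorem vec3_swap (f : V [⋀^Fin 3]→ₗ[ℝ] ℝ) (a b c : V) :
    f ![b, a, c] = -f ![a, b, c] ∧ f ![a, c, b] = -f ![a, b, c] := by
  have h0 := f.map_swap ![a, b, c] (i := 0) (j := 1) (by decide)
  have h1 := f.map_swap ![a, b, c] (i := 1) (j := 2) (by decide)
  refine ⟨Eq.trans ?_ h0, Eq.trans ?_ h1⟩ <;>
    refine congrArg f ?_ <;> ext i : 1 <;> fin_cases i <;> rfl

/-- `(z₀, …, z₄) ↦ A(z₀, z₁, z₂) ⟪v, z₃⟫ ⟪w, z₄⟫`. -/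
def mulForm (A : V [⋀^Fin 3]→ₗ[ℝ] ℝ) (v w : V) : MultilinearMap ℝ (fun _ : Fin 5 => V) ℝ where
  toFun z := A ![z 0, z 1, z 2] * ⟪v, z 3⟫_ℝ * ⟪w, z 4⟫_ℝ
  map_update_add' := by
    intro inst z i a b
    obtain rfl : inst = instDecidableEqFin 5 := Subsingleton.elim _ _
    obtain rfl | rfl | rfl | rfl | rfl : i = 0 ∨ i = 1 ∨ i = 2 ∨ i = 3 ∨ i = 4 := by lia
    all_goals simp [inner_add_right, map_add_vec3]
    all_goals ring
  map_update_smul' := by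
    intro inst z i c a
    obtain rfl : inst = instDecidableEqFin 5 := Subsingleton.elim _ _
    obtain rfl | rfl | rfl | rfl | rfl : i = 0 ∨ i = 1 ∨ i = 2 ∨ i = 3 ∨ i = 4 := by lia
    all_goals simp [inner_smul_right, map_smul_vec3]
    all_goals ring

variable [FiniteDimensional ℝ V]
  [hV : Fact (Module.finrank ℝ V = 5)]

variable (V) in
/-- The standard orthonormal basis of `V`, indexed by `Fin 5`. -/
def onb : OrthonormalBasis (Fin 5) ℝ V :=
  (stdOrthonormalBasis ℝ V).reindex (finCongr hV.out)

theorem sum_stdOrthonormalBasis {A : Type*} [AddCommMonoid A] (f : V → A) :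
    ∑ i, f (stdOrthonormalBasis ℝ V i) = ∑ i, f (onb V i) := by
  refine Fintype.sum_equiv (finCongr hV.out) _ _ fun i => ?_
  simp [onb]

/-- The 2-form `*A`, for an algebraic alternating form `A`. -/
def star3 (o : Orientation ℝ V (Fin 5)) (A : V [⋀^Fin 3]→ₗ[ℝ] ℝ) (v w : V) : ℝ :=
  1 / 6 * ∑ i, ∑ j, ∑ k, A ![onb V i, onb V j, onb V k] *
    o.volumeForm ![onb V i, onb V j, onb V k, v, w]

theorem sum_sum_sum_stdOrthonormalBasis {A : Type*} [AddCommMonoid A] (f : V → V → V → A) :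
    ∑ i, ∑ j, ∑ k, f (stdOrthonormalBasis ℝ V i) (stdOrthonormalBasis ℝ V j)
      (stdOrthonormalBasis ℝ V k) = ∑ i, ∑ j, ∑ k, f (onb V i) (onb V j) (onb V k) := by
  refine (sum_stdOrthonormalBasis fun a => ∑ j, ∑ k, f a (stdOrthonormalBasis ℝ V j)
    (stdOrthonormalBasis ℝ V k)).trans (Finset.sum_congr rfl fun i _ => ?_)
  refine (sum_stdOrthonormalBasis fun b => ∑ k, f (onb V i) b
    (stdOrthonormalBasis ℝ V k)).trans (Finset.sum_congr rfl fun j _ => ?_)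
  exact sum_stdOrthonormalBasis fun c => f (onb V i) (onb V j) c

theorem hodgeStar_apply (o : Orientation ℝ V (Fin 5)) (α : V [⋀^Fin 3]→L[ℝ] ℝ) (v w : V) :
    hodgeStar o α ![v, w] = star3 o α.toAlternatingMap v w := by
  unfold hodgeStar
  rw [sum_sum_sum_stdOrthonormalBasis fun a b c => α ![a, b, c] •
    (((volForm o).curryLeft a).curryLeft b).curryLeft c]
  simp [star3, volForm, ContinuousAlternatingMap.sum_apply]

theorem volumeForm_onb_sq (o : Orientation ℝ V (Fin 5)) : o.volumeForm (onb V) ^ 2 = 1 := by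
  rw [← sq_abs, o.abs_volumeForm_apply_of_orthonormal, one_pow]

theorem volumeForm_eq (o : Orientation ℝ V (Fin 5)) (z : Fin 5 → V) :
    o.volumeForm z = o.volumeForm (onb V) * (onb V).toBasis.det z := by
  conv_lhs => rw [AlternatingMap.eq_smul_basis_det (onb V).toBasis o.volumeForm]
  simp

/-- `A ∧ v♭ ∧ w♭ = (*A)(v, w) vol`, with the wedge product written as an antisymmetrization.
Both sides are alternating 5-forms in `z`, so it suffices to compare them on an orthonormal
basis. -/
theorem alternatization_mulForm (o : Orientation ℝ V (Fin 5)) (A : V [⋀^Fin 3]→ₗ[ℝ] ℝ) (v w : V)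
    (z : Fin 5 → V) :
    ∑ σ : Equiv.Perm (Fin 5), (Equiv.Perm.sign σ : ℤ) * mulForm A v w (z ∘ σ)
      = 6 * star3 o A v w * o.volumeForm z := by
  have hL : ∀ z : Fin 5 → V,
      ∑ σ : Equiv.Perm (Fin 5), ((Equiv.Perm.sign σ : ℤ) : ℝ) * mulForm A v w (z ∘ σ)
        = (MultilinearMap.alternatization (mulForm A v w)) z := by
    intro z
    rw [MultilinearMap.alternatization_apply]
    refine Finset.sum_congr rfl fun σ _ => ?_
    rw [MultilinearMap.domDomCongr_apply, Units.smul_def, zsmul_eq_mul]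
    rfl
  have hbase : (MultilinearMap.alternatization (mulForm A v w)) (onb V)
      = 6 * star3 o A v w * o.volumeForm (onb V) := by
    rw [← hL]
    -- The Leibniz expansion of the volume on `e i, e j, e k, v, w`; the Kronecker symbols then
    -- collapse the sums over `i, j, k`.
    have hdet : ∀ i j k, o.volumeForm ![onb V i, onb V j, onb V k, v, w] = o.volumeForm (onb V) *
        ∑ σ : Equiv.Perm (Fin 5), ((Equiv.Perm.sign σ : ℤ) : ℝ) *
          ((if i = σ 0 then 1 else 0) * (if j = σ 1 then 1 else 0) * (if k = σ 2 then 1 else 0)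
            * ⟪v, onb V (σ 3)⟫_ℝ * ⟪w, onb V (σ 4)⟫_ℝ) := by
      intro i j k
      rw [volumeForm_eq, Module.Basis.det_apply, Matrix.det_apply']
      congr 1
      refine Finset.sum_congr rfl fun σ _ => ?_
      congr 1
      rw [Fin.prod_univ_five]
      simp [Module.Basis.toMatrix_apply, OrthonormalBasis.repr_apply_apply, real_inner_comm,
        eq_comm]
    unfold star3
    simp only [hdet]
    have hsum : ∑ i, ∑ j, ∑ k, A ![onb V i, onb V j, onb V k] * (o.volumeForm (onb V) *
        ∑ σ : Equiv.Perm (Fin 5), ((Equiv.Perm.sign σ : ℤ) : ℝ) *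
          ((if i = σ 0 then 1 else 0) * (if j = σ 1 then 1 else 0) * (if k = σ 2 then 1 else 0)
            * ⟪v, onb V (σ 3)⟫_ℝ * ⟪w, onb V (σ 4)⟫_ℝ)) =
        o.volumeForm (onb V) * ∑ σ : Equiv.Perm (Fin 5), ((Equiv.Perm.sign σ : ℤ) : ℝ) *
          mulForm A v w (onb V ∘ σ) := by
      simp only [Finset.mul_sum]
      refine ((Finset.sum_congr rfl fun i _ => (Finset.sum_congr rfl fun j _ =>
        Finset.sum_comm).trans Finset.sum_comm).trans Finset.sum_comm).trans
          (Finset.sum_congr rfl fun σ _ => ?_)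
      simp [mulForm]
      ring
    rw [hsum]
    linear_combination (-(∑ σ : Equiv.Perm (Fin 5), ((Equiv.Perm.sign σ : ℤ) : ℝ) *
          mulForm A v w (onb V ∘ σ))) * volumeForm_onb_sq (V := V) o
  rw [hL, AlternatingMap.eq_smul_basis_det (onb V).toBasis (MultilinearMap.alternatization _),
    volumeForm_eq o z]
  simp only [AlternatingMap.smul_apply, OrthonormalBasis.coe_toBasis, hbase]
  simp
  ring

theorem volumeForm_sq_of_nodup (o : Orientation ℝ V (Fin 5)) {a b c d e : Fin 5}
    (hinj : [a, b, c, d, e].Nodup) :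
    o.volumeForm ![onb V a, onb V b, onb V c, onb V d, onb V e] ^ 2 = 1 := by
  have hi : Function.Injective ![a, b, c, d, e] := by
    rw [← List.nodup_ofFn]
    simpa using hinj
  let σ := Equiv.ofBijective _ (Finite.injective_iff_bijective.1 hi)
  have : ![onb V a, onb V b, onb V c, onb V d, onb V e] = onb V ∘ σ := by
    ext i : 1; fin_cases i <;> rfl
  rw [this, AlternatingMap.map_perm, ← sq_abs]
  rcases Int.units_eq_one_or (Equiv.Perm.sign σ) with h | h <;>
    simp [h, o.abs_volumeForm_apply_of_orthonormal]

theorem star3_swap (o : Orientation ℝ V (Fin 5)) (A : V [⋀^Fin 3]→ₗ[ℝ] ℝ) (v w : V) :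
    star3 o A v w = -star3 o A w v := by
  unfold star3
  simp only [fun i j k => (vec5_swap o.volumeForm (onb V i) (onb V j) (onb V k) w v).2.2.2,
    mul_neg, Finset.sum_neg_distrib]

/-- `*(u♭ ∧ *A) = ι_u A`. Both sides are alternating 3-forms in `u, v, w`, so it suffices to compare
them on basis vectors `e a, e b, e c`; if `d, e` are the remaining indices, each side then has only
one nonzero term up to permutation. -/
theorem sum_star3_mul_volumeForm (o : Orientation ℝ V (Fin 5)) (A : V [⋀^Fin 3]→ₗ[ℝ] ℝ)
    (u v w : V) :
    ∑ j, ∑ k, star3 o A (onb V j) (onb V k) * o.volumeForm ![u, onb V j, onb V k, v, w]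
      = 2 * A ![u, v, w] := by
  let L : V [⋀^Fin 3]→ₗ[ℝ] ℝ := ∑ j, ∑ k, star3 o A (onb V j) (onb V k) •
    (o.volumeForm.curryLeft (onb V j)).curryLeft (onb V k)
  have hL : ∀ u v w, L ![u, v, w] = ∑ j, ∑ k, star3 o A (onb V j) (onb V k) *
      o.volumeForm ![onb V j, onb V k, u, v, w] := by
    intro u v w
    have hev : ∀ (ι : Type) (t : Finset ι) (F : ι → V [⋀^Fin 3]→ₗ[ℝ] ℝ) (z : Fin 3 → V),
        (∑ i ∈ t, F i) z = ∑ i ∈ t, F i z := fun ι t F z =>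
      map_sum (⟨⟨fun A : V [⋀^Fin 3]→ₗ[ℝ] ℝ => A z, rfl⟩, fun _ _ => rfl⟩ :
        (V [⋀^Fin 3]→ₗ[ℝ] ℝ) →+ ℝ) F t
    simp only [L, hev]
    rfl
  have hLA : L = (2 : ℝ) • A := by
    refine (onb V).toBasis.ext_alternating fun s hs => ?_
    obtain ⟨d, e, hinj⟩ : ∃ d e, [s 0, s 1, s 2, d, e].Nodup := by
      have : ∀ a b c : Fin 5, a ≠ b → a ≠ c → b ≠ c → ∃ d e, [a, b, c, d, e].Nodup := by decide
      exact this _ _ _ (hs.ne (by decide)) (hs.ne (by decide)) (hs.ne (by decide))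
    have huniv : (Finset.univ : Finset (Fin 5)) = {s 0, s 1, s 2, d, e} := by
      have h := List.toFinset_card_of_nodup hinj
      have h' := (Finset.eq_univ_of_card _ (h.trans (by simp))).symm
      simpa using h'
    have hv : (fun i => (onb V).toBasis (s i)) = ![onb V (s 0), onb V (s 1), onb V (s 2)] := by
      ext i : 1; fin_cases i <;> simp
    rw [hv, hL, AlternatingMap.smul_apply, smul_eq_mul]
    generalize s 0 = a at *
    generalize s 1 = b at *
    generalize s 2 = c at *
    have hz : ∀ (z : Fin 5 → V) (i j : Fin 5), z i = z j → i ≠ j → o.volumeForm z = 0 :=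
      fun z i j h hij => o.volumeForm.map_eq_zero_of_eq z h hij
    have hz3 : ∀ (z : Fin 3 → V) (i j : Fin 3), z i = z j → i ≠ j → A z = 0 :=
      fun z i j h hij => A.map_eq_zero_of_eq z h hij
    have hstar : star3 o A (onb V d) (onb V e) = A ![onb V a, onb V b, onb V c] *
        o.volumeForm ![onb V a, onb V b, onb V c, onb V d, onb V e] := by
      unfold star3
      rw [sum_sum_sum_eq_six_mul huniv hinj]
      · ring
      · intro i j k
        rw [(vec3_swap A (onb V j) (onb V i) _).1,
          (vec5_swap o.volumeForm (onb V j) (onb V i) _ _ _).1]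
        ring
      · intro i j k
        rw [(vec3_swap A _ (onb V k) (onb V j)).2,
          (vec5_swap o.volumeForm _ (onb V k) (onb V j) _ _).2.1]
        ring
      · intro i j
        rw [hz3 _ 0 1 rfl (by decide), zero_mul]
      · intro i j
        rw [hz _ 0 3 rfl (by decide), mul_zero]
      · intro i j
        rw [hz _ 0 4 rfl (by decide), mul_zero]
    have hvol : o.volumeForm ![onb V d, onb V e, onb V a, onb V b, onb V c] =
        o.volumeForm ![onb V a, onb V b, onb V c, onb V d, onb V e] := by
      generalize onb V a = a, onb V b = b, onb V c = c, onb V d = d, onb V e = e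
      linarith [(vec5_swap o.volumeForm d e a b c).2.1, (vec5_swap o.volumeForm d a e b c).2.2.1,
        (vec5_swap o.volumeForm d a b e c).2.2.2, (vec5_swap o.volumeForm d a b c e).1,
        (vec5_swap o.volumeForm a d b c e).2.1, (vec5_swap o.volumeForm a b d c e).2.2.1]
    rw [sum_sum_eq_two_mul huniv hinj]
    · rw [hstar, hvol]
      linear_combination 2 * A ![onb V a, onb V b, onb V c] * volumeForm_sq_of_nodup o hinj
    · intro i j
      rw [star3_swap, (vec5_swap o.volumeForm (onb V j) (onb V i) _ _ _).1]
      ring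
    · intro i
      rw [hz _ 0 1 rfl (by decide), mul_zero]
    · intro i
      rw [hz _ 0 2 rfl (by decide), mul_zero]
    · intro i
      rw [hz _ 0 3 rfl (by decide), mul_zero]
    · intro i
      rw [hz _ 0 4 rfl (by decide), mul_zero]
  simp only [fun j k => vec5_cycle o.volumeForm u (onb V j) (onb V k) v w]
  rw [← hL, hLA]
  rfl

end HodgeAlgebra

/-! ### Volumes and directional derivatives -/

section VolumeForm

/-- The alternating form of a function of three vectors that is linear in the first one and
antisymmetric under the two adjacent transpositions. -/
def mkAlternating3 {V : Type*} [AddCommGroup V] [Module ℝ V] (F : V → V → V → ℝ)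
    (hadd : ∀ a a' b c, F (a + a') b c = F a b c + F a' b c)
    (hsmul : ∀ (r : ℝ) a b c, F (r • a) b c = r * F a b c)
    (h12 : ∀ a b c, F a b c = -F b a c) (h23 : ∀ a b c, F a b c = -F a c b) :
    V [⋀^Fin 3]→ₗ[ℝ] ℝ where
  toFun z := F (z 0) (z 1) (z 2)
  map_update_add' := by
    intro inst z i a b
    obtain rfl : inst = instDecidableEqFin 3 := Subsingleton.elim _ _
    have h1 : ∀ a a' b c, F b (a + a') c = F b a c + F b a' c := fun a a' b c => by
      rw [h12, hadd, h12 a, h12 a']; ring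
    have h2 : ∀ a a' b c, F b c (a + a') = F b c a + F b c a' := fun a a' b c => by
      rw [h23, h1, h23 b a, h23 b a']; ring
    obtain rfl | rfl | rfl : i = 0 ∨ i = 1 ∨ i = 2 := by lia
    all_goals simp [hadd, h1, h2]
  map_update_smul' := by
    intro inst z i r a
    obtain rfl : inst = instDecidableEqFin 3 := Subsingleton.elim _ _
    have h1 : ∀ (r : ℝ) a b c, F b (r • a) c = r * F b a c := fun r a b c => by
      rw [h12, hsmul, h12 a]; ring
    have h2 : ∀ (r : ℝ) a b c, F b c (r • a) = r * F b c a := fun r a b c => by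
      rw [h23, h1, h23 b a]; ring
    obtain rfl | rfl | rfl : i = 0 ∨ i = 1 ∨ i = 2 := by lia
    all_goals simp [hsmul, h1, h2]
  map_eq_zero_of_eq' z i j hz hij := by
    have h01 : ∀ a c, F a a c = 0 := fun a c => by linarith [h12 a a c]
    have h12' : ∀ a c, F c a a = 0 := fun a c => by linarith [h23 c a a]
    have h02 : ∀ a c, F a c a = 0 := fun a c => by rw [h23, h01, neg_zero]
    obtain rfl | rfl | rfl : i = 0 ∨ i = 1 ∨ i = 2 := by lia
    all_goals obtain rfl | rfl | rfl : j = 0 ∨ j = 1 ∨ j = 2 := by lia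
    all_goals first | exact absurd rfl hij | simp only [hz, h01, h02, h12']

variable {V : Type*} [NormedAddCommGroup V] [InnerProductSpace ℝ V] [FiniteDimensional ℝ V]
  [hV : Fact (Module.finrank ℝ V = 5)]

/-- The square of the volume is the Gram determinant. -/
theorem volumeForm_sq_eq_det (o : Orientation ℝ V (Fin 5)) (z : Fin 5 → V) :
    o.volumeForm z ^ 2 = Matrix.det (Matrix.of fun i j => ⟪z i, z j⟫_ℝ) := by
  have h : (Matrix.of fun i j => ⟪z i, z j⟫_ℝ) =
      ((onb V).toBasis.toMatrix z).transpose * (onb V).toBasis.toMatrix z := by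
    ext i j
    simp only [Matrix.of_apply, Matrix.mul_apply, Matrix.transpose_apply,
      Module.Basis.toMatrix_apply, OrthonormalBasis.coe_toBasis_repr_apply,
      OrthonormalBasis.repr_apply_apply]
    rw [← (onb V).sum_inner_mul_inner (z i) (z j)]
    simp only [real_inner_comm]
  rw [h, Matrix.det_mul, Matrix.det_transpose, volumeForm_eq, mul_pow, volumeForm_onb_sq,
    Module.Basis.det_apply]
  ring

theorem volumeForm_update_onb (o : Orientation ℝ V (Fin 5)) (k : Fin 5) (a : V) :
    o.volumeForm (Function.update (onb V) k a) = ⟪onb V k, a⟫_ℝ * o.volumeForm (onb V) := by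
  conv_lhs => rw [← (onb V).sum_repr' a]
  rw [AlternatingMap.map_update_sum, Finset.sum_eq_single k]
  · simp [AlternatingMap.map_update_smul]
  · intro j _ hj
    rw [AlternatingMap.map_update_smul, AlternatingMap.map_update_self _ _ hj.symm, smul_zero]
  · simp

theorem sum_mulForm_update {V : Type*} [NormedAddCommGroup V] [InnerProductSpace ℝ V]
    (A : V [⋀^Fin 3]→ₗ[ℝ] ℝ) (v w : V) (z n : Fin 5 → V) :
    ∑ k, mulForm A v w (Function.update z k (n k)) =
      A ![n 0, z 1, z 2] * ⟪v, z 3⟫_ℝ * ⟪w, z 4⟫_ℝ + A ![z 0, n 1, z 2] * ⟪v, z 3⟫_ℝ * ⟪w, z 4⟫_ℝ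
      + A ![z 0, z 1, n 2] * ⟪v, z 3⟫_ℝ * ⟪w, z 4⟫_ℝ + A ![z 0, z 1, z 2] * ⟪v, n 3⟫_ℝ * ⟪w, z 4⟫_ℝ
      + A ![z 0, z 1, z 2] * ⟪v, z 3⟫_ℝ * ⟪w, n 4⟫_ℝ := by
  simp [Fin.sum_univ_five, mulForm]

/-- The terms in the derivative of `alternatization_mulForm` that come from moving the basis: if the
basis vectors move by `N`, the volume changes by the trace of `N`. -/
theorem sum_mulForm_update_onb (o : Orientation ℝ V (Fin 5)) (A : V [⋀^Fin 3]→ₗ[ℝ] ℝ) (v w : V)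
    (N : V → V) :
    ∑ σ : Equiv.Perm (Fin 5), (Equiv.Perm.sign σ : ℤ) *
        ∑ k, mulForm A v w (Function.update (onb V ∘ σ) k (N (onb V (σ k))))
      = 6 * star3 o A v w * o.volumeForm (onb V) * ∑ k, ⟪onb V k, N (onb V k)⟫_ℝ := by
  have h : ∀ (σ : Equiv.Perm (Fin 5)) k, Function.update (onb V ∘ σ) k (N (onb V (σ k))) =
      Function.update (onb V) (σ k) (N (onb V (σ k))) ∘ σ := fun σ k =>
    (Function.update_comp_eq_of_injective _ σ.injective _ _).symm
  have h2 : ∀ σ : Equiv.Perm (Fin 5),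
      ∑ k, mulForm A v w (Function.update (onb V ∘ σ) k (N (onb V (σ k)))) =
      ∑ k, mulForm A v w (Function.update (onb V) k (N (onb V k)) ∘ σ) := fun σ =>
    (Finset.sum_congr rfl fun k _ => by rw [h]).trans
      (Equiv.sum_comp σ fun k => mulForm A v w (Function.update (onb V) k (N (onb V k)) ∘ σ))
  simp only [h2, Finset.mul_sum]
  rw [Finset.sum_comm]
  refine Finset.sum_congr rfl fun k _ => ?_
  rw [alternatization_mulForm o, volumeForm_update_onb]
  ring

theorem volumeForm_orientation_pos {V : Type*} [NormedAddCommGroup V] [InnerProductSpace ℝ V]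
    [hV : Fact (Module.finrank ℝ V = 5)] (b : Module.Basis (Fin 5) ℝ V) :
    0 < b.orientation.volumeForm b := by
  let f := b.orientation.finOrthonormalBasis (by norm_num) hV.out
  have hf : f.toBasis.orientation = b.orientation :=
    b.orientation.finOrthonormalBasis_orientation _ _
  rw [b.orientation.volumeForm_robust f hf]
  exact (Module.Basis.orientation_eq_iff_det_pos _ _).1 hf

end VolumeForm

section DirDeriv

variable {M : Type*} [TopologicalSpace M] [ChartedSpace E5 M]

/-- The function `f` is differentiable at `x`, with derivative `d` in the direction `u`. -/
def HasDirDeriv (f : M → ℝ) (x : M) (u : TangentSpace (𝓡 5) x) (d : ℝ) : Prop :=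
  MDifferentiableAt (𝓡 5) 𝓘(ℝ, ℝ) f x ∧ mvfderiv (𝓡 5) f x u = d

namespace HasDirDeriv

variable {x : M} {u : TangentSpace (𝓡 5) x}

theorem const (c : ℝ) : HasDirDeriv (fun _ : M => c) x u 0 :=
  ⟨mdifferentiableAt_const, by rw [mvfderiv_const]; rfl⟩

theorem add {f g : M → ℝ} {a b : ℝ} (hf : HasDirDeriv f x u a) (hg : HasDirDeriv g x u b) :
    HasDirDeriv (fun y => f y + g y) x u (a + b) :=
  ⟨hf.1.add hg.1, (DFunLike.congr_fun (mvfderiv_add hf.1 hg.1) u).trans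
    (congrArg₂ _ hf.2 hg.2)⟩

theorem mul {f g : M → ℝ} {a b : ℝ} (hf : HasDirDeriv f x u a) (hg : HasDirDeriv g x u b) :
    HasDirDeriv (fun y => f y * g y) x u (a * g x + f x * b) := by
  refine ⟨hf.1.mul hg.1, (DFunLike.congr_fun (mvfderiv_mul hf.1 hg.1) u).trans ?_⟩
  simp [hf.2, hg.2]
  ring

theorem sum {ι : Type*} (s : Finset ι) {f : ι → M → ℝ} {a : ι → ℝ}
    (hf : ∀ i, HasDirDeriv (f i) x u (a i)) :
    HasDirDeriv (fun y => ∑ i ∈ s, f i y) x u (∑ i ∈ s, a i) := by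
  classical
  induction s using Finset.induction_on with
  | empty => simpa using const 0
  | insert i s hi ih => simpa [hi] using (hf i).add ih

theorem congr {f g : M → ℝ} {a : ℝ} (hf : HasDirDeriv f x u a) (h : f =ᶠ[𝓝 x] g) :
    HasDirDeriv g x u a :=
  ⟨hf.1.congr_of_eventuallyEq h.symm, by rw [← hf.2, mvfderiv_congr h]⟩

theorem comp {f : M → ℝ} {a b : ℝ} {φ : ℝ → ℝ} (hf : HasDirDeriv f x u a)
    (hφ : HasDerivAt φ b (f x)) : HasDirDeriv (fun y => φ (f y)) x u (b * a) := by
  refine ⟨hφ.differentiableAt.comp_mdifferentiableAt hf.1, ?_⟩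
  have h := (hφ.hasFDerivAt.hasMFDerivAt.comp x hf.1.hasMFDerivAt).mfderiv
  have h2 : mvfderiv (𝓡 5) (φ ∘ f) x u = mvfderiv (𝓡 5) f x u • b := DFunLike.congr_fun h u
  rw [hf.2, smul_eq_mul, mul_comm] at h2
  exact h2

/-- The derivative of the determinant at the identity matrix is the trace. -/
theorem det {G : M → Matrix (Fin 5) (Fin 5) ℝ} {a : Fin 5 → Fin 5 → ℝ}
    (hG : ∀ i j, HasDirDeriv (fun y => G y i j) x u (a i j)) (h1 : G x = 1) :
    HasDirDeriv (fun y => (G y).det) x u (∑ i, a i i) := by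
  have hp : ∀ (σ : Equiv.Perm (Fin 5)) (s : Finset (Fin 5)),
      HasDirDeriv (fun y => ∏ i ∈ s, G y (σ i) i) x u
        (∑ i ∈ s, (∏ j ∈ s.erase i, G x (σ j) j) * a (σ i) i) := by
    intro σ s
    induction s using Finset.induction_on with
    | empty => simpa using const 1
    | insert i s hi ih =>
      simp only [Finset.prod_insert hi]
      convert (hG (σ i) i).mul ih using 1
      rw [Finset.sum_insert hi, Finset.erase_insert hi, Finset.mul_sum]
      congr 1
      · ring
      · refine Finset.sum_congr rfl fun j hj => ?_
        have hij : i ≠ j := fun h => hi (h ▸ hj)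
        rw [Finset.erase_insert_of_ne hij,
          Finset.prod_insert (fun h => hi (Finset.mem_of_mem_erase h))]
        ring
  have hd := sum Finset.univ fun σ : Equiv.Perm (Fin 5) =>
    (const ((Equiv.Perm.sign σ : ℤ) : ℝ)).mul (hp σ Finset.univ)
  simp only [zero_mul, zero_add] at hd
  rw [Finset.sum_eq_single 1] at hd
  · simpa [Matrix.det_apply', h1] using hd
  · -- A nontrivial permutation moves at least two indices, so each product has a zero factor.
    intro σ _ hσ
    obtain ⟨k, hk⟩ : ∃ k, σ k ≠ k := by
      by_contra! h
      exact hσ (Equiv.ext h)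
    have : ∀ i, ∏ j ∈ Finset.univ.erase i, G x (σ j) j = 0 := by
      intro i
      by_cases hik : i = k
      · subst hik
        refine Finset.prod_eq_zero (i := σ i) (by simpa using hk) ?_
        rw [h1, Matrix.one_apply_ne]
        exact fun h => hk (σ.injective h)
      · exact Finset.prod_eq_zero (i := k) (by simpa using Ne.symm hik)
          (by rw [h1, Matrix.one_apply_ne hk])
    simp [this]
  · simp

end HasDirDeriv

end DirDeriv

/-! ### The Hodge star is parallel -/

section HodgeStarDerivative

variable {M : Type*} [TopologicalSpace M] [ChartedSpace E5 M] [IsManifold (𝓡 5) ∞ M]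
  [RiemannianBundle (fun x : M => TangentSpace (𝓡 5) x)]

/-- The volume at `y` of the frame of coordinate fields through the orthonormal basis `onb` at
`x`. -/
def frameVolume (x y : M) : ℝ :=
  (chartOrientation x y).volumeForm fun i => constField x (onb (TS x) i) y

theorem frameVolume_self_sq (x : M) : frameVolume x x ^ 2 = 1 := by
  simp only [frameVolume, constField_self]
  exact volumeForm_onb_sq _

/-- The volume of the frame has constant sign near `x`: the coordinate frame of the chart is
positive for `chartOrientation x y`, and the frame is obtained from it by a constant matrix, whose
determinant is `c`. -/
theorem exists_frameVolume_eq (x : M) :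
    ∃ c : ℝ, ∀ᶠ y in 𝓝 x, ∃ r > 0, frameVolume x y = r * c := by
  let b := (EuclideanSpace.basisFun (Fin 5) ℝ).toBasis
  let t := trivializationAt E5 (TangentSpace (𝓡 5)) x
  refine ⟨b.det fun i => chartL x (onb (TS x) i), ?_⟩
  filter_upwards [t.open_baseSet.mem_nhds (FiberBundle.mem_baseSet_trivializationAt E5 _ x)]
    with y hy
  refine ⟨_, volumeForm_orientation_pos (t.basisAt b hy), ?_⟩
  have ho : chartOrientation x y = (t.basisAt b hy).orientation := dif_pos hy
  rw [frameVolume, ho, AlternatingMap.eq_smul_basis_det (t.basisAt b hy)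
    (Module.Basis.orientation _).volumeForm]
  simp only [AlternatingMap.smul_apply, Module.Basis.det_self, smul_eq_mul, mul_one]
  congr 1
  rw [Trivialization.basisAt, Module.Basis.det_map]
  refine congrArg b.det (funext fun i => ?_)
  exact (congrArg (t.linearEquivAt ℝ y hy) (Trivialization.symmL_apply t hy _)).trans
    ((t.linearEquivAt ℝ y hy).apply_symm_apply _)

theorem frameVolume_eq_sqrt (x : M) :
    ∀ᶠ y in 𝓝 x, frameVolume x y = frameVolume x x * √(Matrix.det (Matrix.of fun i j =>
      ⟪constField x (onb (TS x) i) y, constField x (onb (TS x) j) y⟫_ℝ)) := by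
  obtain ⟨c, hc⟩ := exists_frameVolume_eq x
  obtain ⟨r₀, hr₀, h0⟩ := hc.self_of_nhds
  filter_upwards [hc] with y ⟨r, hr, hy⟩
  rw [← volumeForm_sq_eq_det (chartOrientation x y), Real.sqrt_sq_eq_abs]
  change _ = _ * |frameVolume x y|
  have hx := frameVolume_self_sq x
  rw [h0] at hx ⊢
  rw [hy]
  have h1 : |r₀ * c| = 1 := by
    rw [← abs_one]
    exact (sq_eq_sq_iff_abs_eq_abs _ _).1 (by rw [hx, one_pow])
  rw [abs_mul, abs_of_pos hr₀] at h1
  rw [abs_mul, abs_of_pos hr]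
  linear_combination (-(r * c)) * h1

variable [IsContMDiffRiemannianBundle (𝓡 5) ∞ E5 (fun x : M => TangentSpace (𝓡 5) x)]

theorem hasDirDeriv_inner {D : LinearConnection M} (hD : D.IsMetricCompatible) {x : M}
    {σ τ : ∀ y : M, TangentSpace (𝓡 5) y} (hσ : DiffAt σ x) (hτ : DiffAt τ x)
    (u : TangentSpace (𝓡 5) x) :
    HasDirDeriv (fun y => ⟪σ y, τ y⟫_ℝ) x u (⟪D σ x u, τ x⟫_ℝ + ⟪σ x, D τ x u⟫_ℝ) :=
  ⟨mdifferentiableAt_inner hσ hτ, mvfderiv_inner hD hσ hτ u⟩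

/-- The volume form is parallel: the derivative of the volume of the frame is that of the frame
vectors. -/
theorem hasDirDeriv_frameVolume {D : LinearConnection M} (hD : D.IsMetricCompatible) {x : M}
    (u : TangentSpace (𝓡 5) x) :
    HasDirDeriv (frameVolume x) x u (frameVolume x x *
      ∑ k, ⟪onb (TS x) k, D (constField x (onb (TS x) k)) x u⟫_ℝ) := by
  have hdet := HasDirDeriv.det (x := x) (u := u) (G := fun y => Matrix.of fun i j =>
      ⟪constField x (onb (TS x) i) y, constField x (onb (TS x) j) y⟫_ℝ)
    (fun i j => hasDirDeriv_inner hD (diffAt_constField _) (diffAt_constField _) u) (by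
      ext i j
      simp [Matrix.one_apply, (onb (TS x)).inner_eq_ite])
  have h1 : Matrix.det (Matrix.of fun i j => ⟪constField x (onb (TS x) i) x,
      constField x (onb (TS x) j) x⟫_ℝ) = 1 := by
    rw [← volumeForm_sq_eq_det (chartOrientation x x)]
    exact frameVolume_self_sq x
  have hs := hdet.comp (φ := Real.sqrt) (Real.hasDerivAt_sqrt (by rw [h1]; norm_num))
  have hm := ((HasDirDeriv.const (frameVolume x x)).mul hs).congr
    ((frameVolume_eq_sqrt x).mono fun y hy => hy.symm)
  convert hm using 1
  rw [h1, Real.sqrt_one]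
  simp only [constField_self, Finset.sum_add_distrib, real_inner_comm]
  ring

/-- The Hodge star is parallel: if `A = ∇_u T` at `x`, then `∇_u (*T) = *A`. -/
theorem hasDirDeriv_star {D : LinearConnection M} (hD : D.IsMetricCompatible) {x : M}
    (u : TangentSpace (𝓡 5) x) (T : ∀ y : M, TS y [⋀^Fin 3]→ₗ[ℝ] ℝ) (A : TS x [⋀^Fin 3]→ₗ[ℝ] ℝ)
    (hA : ∀ a b c : TangentSpace (𝓡 5) x,
      HasDirDeriv (fun y => T y ![constField x a y, constField x b y, constField x c y]) x u
        (A ![a, b, c] + T x ![D (constField x a) x u, b, c] + T x ![a, D (constField x b) x u, c]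
          + T x ![a, b, D (constField x c) x u])) (v w : TangentSpace (𝓡 5) x) :
    HasDirDeriv (fun y => star3 (chartOrientation x y) (T y) (constField x v y) (constField x w y))
      x u (star3 (chartOrientation x x) A v w
        + star3 (chartOrientation x x) (T x) (D (constField x v) x u) w
        + star3 (chartOrientation x x) (T x) v (D (constField x w) x u)) := by
  set N : TS x → TS x := fun a => D (constField x a) x u with hN
  set o := chartOrientation x x
  set e := onb (TS x)
  let z : ∀ y : M, Fin 5 → TS y := fun y i => constField x (e i) y
  have hzx : z x = e := by ext1 i; exact constField_self x _
  have hmul : ∀ σ : Equiv.Perm (Fin 5), HasDirDeriv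
      (fun y => mulForm (T y) (constField x v y) (constField x w y) (z y ∘ σ)) x u
      (mulForm A v w (e ∘ σ) + mulForm (T x) (N v) w (e ∘ σ) + mulForm (T x) v (N w) (e ∘ σ)
        + ∑ k, mulForm (T x) v w (Function.update (e ∘ σ) k (N (e (σ k))))) := by
    intro σ
    have h := ((hA (e (σ 0)) (e (σ 1)) (e (σ 2))).mul
      (hasDirDeriv_inner hD (diffAt_constField v) (diffAt_constField (e (σ 3))) u)).mul
      (hasDirDeriv_inner hD (diffAt_constField w) (diffAt_constField (e (σ 4))) u)
    simp only [constField_self] at h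
    have hval := sum_mulForm_update (T x) v w (e ∘ σ) fun k => N (e (σ k))
    rw [hval]
    refine ⟨h.1, h.2.trans ?_⟩
    simp only [mulForm, MultilinearMap.coe_mk, Function.comp, hN]
    ring
  have hsum := HasDirDeriv.sum Finset.univ fun σ : Equiv.Perm (Fin 5) =>
    (HasDirDeriv.const ((Equiv.Perm.sign σ : ℤ) : ℝ)).mul (hmul σ)
  simp only [alternatization_mulForm (chartOrientation x _), zero_mul, zero_add, mul_add,
    Finset.sum_add_distrib] at hsum
  have hupd := sum_mulForm_update_onb o (T x) v w N
  rw [hupd] at hsum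
  have hvol := hasDirDeriv_frameVolume hD u
  have hne : frameVolume x x ≠ 0 := fun h => by simpa [h] using frameVolume_self_sq x
  have hfe : frameVolume x x = o.volumeForm e := by
    simp only [frameVolume, constField_self]; rfl
  have hinv := hvol.comp (φ := fun t => t⁻¹) (hasDerivAt_inv hne)
  have hev : ∀ᶠ y in 𝓝 x, frameVolume x y ≠ 0 :=
    hvol.1.continuousAt.eventually_ne hne
  have hfin := ((HasDirDeriv.const (1 / 6)).mul (hsum.mul hinv)).congr (g := fun y =>
    star3 (chartOrientation x y) (T y) (constField x v y) (constField x w y)) (by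
      filter_upwards [hev] with y hy
      change 1 / 6 * (6 * _ * frameVolume x y * (frameVolume x y)⁻¹) = _
      field_simp)
  convert hfin using 1
  rw [hzx, ← hfe, constField_self, constField_self]
  field_simp
  ring

end HodgeStarDerivative

/-! ### The divergence of the torsion -/

section Traces

/-- The sum is the trace of `L* L'`. -/
theorem sum_inner_apply_apply {ι κ V : Type*} [Fintype ι] [Fintype κ] [NormedAddCommGroup V]
    [InnerProductSpace ℝ V] [FiniteDimensional ℝ V] (b : OrthonormalBasis ι ℝ V)
    (e : OrthonormalBasis κ ℝ V) (L L' : V →ₗ[ℝ] V) :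
    ∑ i, ⟪L (b i), L' (b i)⟫_ℝ = ∑ k, ⟪L (e k), L' (e k)⟫_ℝ := by
  have h : ∀ v, ⟪L v, L' v⟫_ℝ = ⟪v, (LinearMap.adjoint L ∘ₗ L') v⟫_ℝ := fun v =>
    (LinearMap.adjoint_inner_right L v (L' v)).symm
  simp only [h]
  rw [← LinearMap.trace_eq_sum_inner _ b, ← LinearMap.trace_eq_sum_inner _ e]

/-- If `F i` is the derivative of a 3-form `α` in the direction of the `i`-th basis vector, then the
left side computes `6 (*d*α)(v, w)`, and the right side is a divergence. -/
theorem sum_cyclic_star3_mul_volumeForm {V : Type*} [NormedAddCommGroup V] [InnerProductSpace ℝ V]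
    [FiniteDimensional ℝ V] [Fact (Module.finrank ℝ V = 5)] (o : Orientation ℝ V (Fin 5))
    (F : Fin 5 → V [⋀^Fin 3]→ₗ[ℝ] ℝ) (v w : V) :
    ∑ i, ∑ j, ∑ k, (star3 o (F i) (onb V j) (onb V k) - star3 o (F j) (onb V i) (onb V k)
        + star3 o (F k) (onb V i) (onb V j)) * o.volumeForm ![onb V i, onb V j, onb V k, v, w]
      = 6 * ∑ i, F i ![onb V i, v, w] := by
  have h0 : ∑ i, ∑ j, ∑ k, star3 o (F i) (onb V j) (onb V k) *
      o.volumeForm ![onb V i, onb V j, onb V k, v, w] = 2 * ∑ i, F i ![onb V i, v, w] := by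
    rw [Finset.mul_sum]
    exact Finset.sum_congr rfl fun i _ => sum_star3_mul_volumeForm o (F i) _ v w
  have h1 : ∑ i, ∑ j, ∑ k, star3 o (F j) (onb V i) (onb V k) *
      o.volumeForm ![onb V i, onb V j, onb V k, v, w] = -(2 * ∑ i, F i ![onb V i, v, w]) := by
    rw [Finset.sum_comm, ← h0]
    simp only [← Finset.sum_neg_distrib]
    refine Finset.sum_congr rfl fun i _ => Finset.sum_congr rfl fun j _ =>
      Finset.sum_congr rfl fun k _ => ?_
    rw [(vec5_swap o.volumeForm (onb V i) (onb V j) (onb V k) v w).1]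
    ring
  have h2 : ∑ i, ∑ j, ∑ k, star3 o (F k) (onb V i) (onb V j) *
      o.volumeForm ![onb V i, onb V j, onb V k, v, w] = 2 * ∑ i, F i ![onb V i, v, w] := by
    rw [← h0, (Finset.sum_congr rfl fun i _ => Finset.sum_comm :
      ∑ i, ∑ j, ∑ k, star3 o (F k) (onb V i) (onb V j) *
        o.volumeForm ![onb V i, onb V j, onb V k, v, w] = _), Finset.sum_comm]
    refine Finset.sum_congr rfl fun i _ => Finset.sum_congr rfl fun j _ =>
      Finset.sum_congr rfl fun k _ => ?_
    rw [← vec5_cycle o.volumeForm (onb V i)]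
  simp only [add_mul, sub_mul, Finset.sum_add_distrib, Finset.sum_sub_distrib]
  rw [h0, h1, h2]
  ring

end Traces

section TorsionDivergence

variable {M : Type*} [TopologicalSpace M] [ChartedSpace E5 M] [IsManifold (𝓡 5) ∞ M]
  [RiemannianBundle (fun x : M => TangentSpace (𝓡 5) x)]

theorem torsionForm_apply {Γ : LinearConnection M} (hs : HasSkewTorsion Γ) {x : M}
    (u v w : TangentSpace (𝓡 5) x) :
    torsionForm Γ hs x ![u, v, w] = ⟪u, Γ.torsion x v w⟫_ℝ := rfl

/-- The quadratic term does not depend on the orthonormal basis. -/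
theorem sum_torsionForm_mul_torsionForm {Γ : LinearConnection M} (hs : HasSkewTorsion Γ) {x : M}
    (e : OrthonormalBasis (Fin 5) ℝ (TS x)) (i j : Fin 5) :
    ∑ k, ∑ l, torsionForm Γ hs x ![e i, e k, e l] * torsionForm Γ hs x ![e j, e k, e l] =
      ∑ k, ⟪Γ.torsion x (stdOrthonormalBasis ℝ (TS x) k) (e i),
        Γ.torsion x (stdOrthonormalBasis ℝ (TS x) k) (e j)⟫_ℝ := by
  have h := sum_inner_apply_apply (stdOrthonormalBasis ℝ (TS x)) e
    ((Γ.torsion x).flip (e i) : TS x →ₗ[ℝ] TS x) ((Γ.torsion x).flip (e j) : TS x →ₗ[ℝ] TS x)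
  refine Eq.trans (Finset.sum_congr rfl fun k _ => ?_) h.symm
  rw [← e.sum_inner_mul_inner]
  refine Finset.sum_congr rfl fun l _ => ?_
  have hc : ∀ i, torsionForm Γ hs x ![e i, e k, e l] = -⟪e l, Γ.torsion x (e k) (e i)⟫_ℝ := by
    intro i
    rw [torsionForm_apply, inner_torsion_swap, hs, inner_torsion_swap, neg_neg]
  rw [hc, hc, real_inner_comm (e l)]
  simp

variable [IsContMDiffRiemannianBundle (𝓡 5) ∞ E5 (fun x : M => TangentSpace (𝓡 5) x)] [T2Space M]

/-- The 3-form `∇_u T`. -/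
def nablaForm {LC Γ : LinearConnection M} (hLC : IsLeviCivita LC) (hm : Γ.IsMetricCompatible)
    (hs : HasSkewTorsion Γ) (hΓ : CovariantDerivative.ContMDiffCovariantDerivative Γ ∞) {x : M}
    (u : TangentSpace (𝓡 5) x) : TS x [⋀^Fin 3]→ₗ[ℝ] ℝ :=
  mkAlternating3 (nablaT LC Γ x u) (nablaT_add hLC hm hs hΓ u)
    (fun r => nablaT_smul hLC hm hs hΓ r u)
    (nablaT_swap_left hs x u) (nablaT_swap_right x u)

theorem nablaForm_apply {LC Γ : LinearConnection M} (hLC : IsLeviCivita LC)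
    (hm : Γ.IsMetricCompatible) (hs : HasSkewTorsion Γ)
    (hΓ : CovariantDerivative.ContMDiffCovariantDerivative Γ ∞) {x : M}
    (u a b c : TangentSpace (𝓡 5) x) :
    nablaForm hLC hm hs hΓ u ![a, b, c] = nablaT LC Γ x u a b c := rfl

theorem hasDirDeriv_star_torsion {LC Γ : LinearConnection M} (hLC : IsLeviCivita LC)
    (hm : Γ.IsMetricCompatible) (hs : HasSkewTorsion Γ)
    (hΓ : CovariantDerivative.ContMDiffCovariantDerivative Γ ∞) {x : M}
    (u v w : TangentSpace (𝓡 5) x) :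
    HasDirDeriv (fun y => hodgeStar (chartOrientation x y) (torsionForm Γ hs y)
        ![constField x v y, constField x w y]) x u
      (star3 (chartOrientation x x) (nablaForm hLC hm hs hΓ u) v w
        + star3 (chartOrientation x x) (torsionForm Γ hs x).toAlternatingMap
            (LC (constField x v) x u) w
        + star3 (chartOrientation x x) (torsionForm Γ hs x).toAlternatingMap
            v (LC (constField x w) x u)) := by
  have h := hasDirDeriv_star hLC.metric u (fun y => (torsionForm Γ hs y).toAlternatingMap)
    (nablaForm hLC hm hs hΓ u) (fun a b c => ⟨mdifferentiableAt_inner_torsion hLC hm hs hΓ a b c, by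
      rw [nablaForm_apply]
      unfold nablaT
      change _ = _ + ⟪_, Γ.torsion x b c⟫_ℝ + ⟪a, Γ.torsion x _ c⟫_ℝ + ⟪a, Γ.torsion x b _⟫_ℝ
      simp only [Matrix.cons_val_zero, Matrix.cons_val_one, Matrix.cons_val]
      ring!⟩) v w
  simp only [← hodgeStar_apply (chartOrientation x _)] at h ⊢
  exact h

/-- The terms with derivatives of the coordinate fields cancel since `∇_u V = ∇_v U`. -/
theorem extDerivAt_star_torsion {LC Γ : LinearConnection M} (hLC : IsLeviCivita LC)
    (hm : Γ.IsMetricCompatible) (hs : HasSkewTorsion Γ)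
    (hΓ : CovariantDerivative.ContMDiffCovariantDerivative Γ ∞) {x : M}
    (u v w : TangentSpace (𝓡 5) x) :
    extDerivAt (fun y => hodgeStar (chartOrientation x y) (torsionForm Γ hs y)) x ![u, v, w] =
      star3 (chartOrientation x x) (nablaForm hLC hm hs hΓ u) v w
        - star3 (chartOrientation x x) (nablaForm hLC hm hs hΓ v) u w
        + star3 (chartOrientation x x) (nablaForm hLC hm hs hΓ w) u v := by
  have h := hasDirDeriv_star_torsion hLC hm hs hΓ (x := x)
  rw [extDerivAt_apply _ (fun v w => (h 0 v w).1), (h u v w).2, (h v u w).2, (h w u v).2,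
    hLC.symm_self v u, hLC.symm_self w u, hLC.symm_self w v,
    star3_swap _ _ v (LC (constField x w) x u)]
  ring

/-- `*d*T` is the divergence of `T`. -/
theorem starDStar_torsionForm {LC Γ : LinearConnection M} (hLC : IsLeviCivita LC)
    (hm : Γ.IsMetricCompatible) (hs : HasSkewTorsion Γ)
    (hΓ : CovariantDerivative.ContMDiffCovariantDerivative Γ ∞) {x : M}
    (v w : TangentSpace (𝓡 5) x) :
    starDStar (torsionForm Γ hs) x ![v, w] =
      ∑ i, nablaT LC Γ x (stdOrthonormalBasis ℝ (TS x) i) (stdOrthonormalBasis ℝ (TS x) i) v w := by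
  rw [sum_stdOrthonormalBasis fun a : TS x => nablaT LC Γ x a a v w]
  unfold starDStar
  rw [hodgeStar_apply]
  unfold star3
  have h := sum_cyclic_star3_mul_volumeForm (chartOrientation x x)
    (fun i => nablaForm hLC hm hs hΓ (onb (TS x) i)) v w
  simp only [nablaForm_apply] at h
  simp only [← extDerivAt_star_torsion hLC hm hs hΓ] at h
  refine (congrArg (1 / 6 * ·) h).trans ?_
  ring

theorem ricci_leviCivita_eq {LC Γ : LinearConnection M} (hLC : IsLeviCivita LC)
    (hm : Γ.IsMetricCompatible) (hs : HasSkewTorsion Γ)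
    (hΓ : CovariantDerivative.ContMDiffCovariantDerivative Γ ∞) {x : M}
    (e : OrthonormalBasis (Fin 5) ℝ (TS x)) (i j : Fin 5) :
    ricci LC x (e i) (e j) = ricci Γ x (e i) (e j)
        + 1 / 4 * ∑ k, ∑ l, torsionForm Γ hs x ![e i, e k, e l] *
            torsionForm Γ hs x ![e j, e k, e l]
        + 1 / 2 * starDStar (torsionForm Γ hs) x ![e i, e j] := by
  rw [sum_torsionForm_mul_torsionForm, starDStar_torsionForm hLC hm hs hΓ,
    ricci_eq_ricci_leviCivita_add hLC hm hs hΓ]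
  simp only [nablaT_swap_right x _ _ (e i) (e j), Finset.sum_neg_distrib]
  ring

/-- The skew symmetric part of `Ric^Γ` is `-(1/2) *d*T`. -/
theorem ricci_sub_ricci_swap {LC Γ : LinearConnection M} (hLC : IsLeviCivita LC)
    (hm : Γ.IsMetricCompatible) (hs : HasSkewTorsion Γ)
    (hΓ : CovariantDerivative.ContMDiffCovariantDerivative Γ ∞) {x : M}
    (v w : TangentSpace (𝓡 5) x) :
    ricci Γ x v w - ricci Γ x w v = -starDStar (torsionForm Γ hs) x ![v, w] := by
  rw [starDStar_torsionForm hLC hm hs hΓ, ricci_eq_ricci_leviCivita_add hLC hm hs hΓ,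
    ricci_eq_ricci_leviCivita_add hLC hm hs hΓ w v, ricci_leviCivita_symm hLC v w]
  simp only [nablaT_swap_right x _ _ w v, Finset.sum_neg_distrib, real_inner_comm]
  ring

end TorsionDivergence

end SO3Geometry

end

theorem mainTheorem11 {M : Type*} [TopologicalSpace M] [T2Space M] [SecondCountableTopology M]
    [ChartedSpace SO3Geometry.E5 M] [IsManifold (𝓡 5) ∞ M]
    [RiemannianBundle (fun x : M => TangentSpace (𝓡 5) x)]
    [IsContMDiffRiemannianBundle (𝓡 5) ∞ SO3Geometry.E5 (fun x : M => TangentSpace (𝓡 5) x)]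
    (S : SO3Geometry.SO3Structure M) (hS : S.IsNearlyIntegrable)
    (LC : SO3Geometry.LinearConnection M) (hLC : SO3Geometry.IsLeviCivita LC)
    (Γ : SO3Geometry.LinearConnection M) (hΓ : S.IsCharacteristic Γ) :
    (∀ (x : M) (e : OrthonormalBasis (Fin 5) ℝ (SO3Geometry.TS x)) (i j : Fin 5),
      SO3Geometry.ricci LC x (e i) (e j) = SO3Geometry.ricci Γ x (e i) (e j)
        + 1 / 4 * ∑ k, ∑ l, SO3Geometry.torsionForm Γ hΓ.skew x ![e i, e k, e l] *
            SO3Geometry.torsionForm Γ hΓ.skew x ![e j, e k, e l]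
        + 1 / 2 * SO3Geometry.starDStar (SO3Geometry.torsionForm Γ hΓ.skew) x ![e i, e j]) ∧
    ((∀ x : M, SO3Geometry.codifferential (SO3Geometry.torsionForm Γ hΓ.skew) x = 0) ↔
      ∀ (x : M) (v w : SO3Geometry.TS x),
        SO3Geometry.ricci Γ x v w = SO3Geometry.ricci Γ x w v) := by
  refine ⟨fun x e i j => SO3Geometry.ricci_leviCivita_eq hLC hΓ.metric hΓ.skew hΓ.smooth e i j, ?_⟩
  have h := fun x => SO3Geometry.ricci_sub_ricci_swap (x := x) hLC hΓ.metric hΓ.skew hΓ.smooth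
  refine forall_congr' fun x => ⟨fun h0 v w => ?_, fun hsymm => ?_⟩
  · have h1 : SO3Geometry.codifferential (SO3Geometry.torsionForm Γ hΓ.skew) x ![v, w] = 0 := by
      rw [h0]; rfl
    exact sub_eq_zero.1 ((h x v w).trans h1)
  · ext z
    have hz : z = ![z 0, z 1] := by ext i : 1; fin_cases i <;> rfl
    rw [hz]
    exact (h x _ _).symm.trans (sub_eq_zero.2 (hsymm _ _))
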